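/- All sets are subsets of $\omega$. A Turing ideal $\mathcal I$ is a collection of sets closed under $\le_T$ and $\oplus$, presented together with a fixed exact pair $A_0,A_1$ (so $S\in\mathcal I$ iff $S\le_T A_0$ and $S\le_T A_1$); $\Sigma^0_n(\mathcal I)$ and $\Delta^0_n(\mathcal I)$ mean $\Sigma^0_n(A_0\oplus A_1)$ and $\Delta^0_n(A_0\oplus A_1)$. An $\mathcal I$-condition is a pair $(D,S)$ with $D$ finite, $S\in\mathcal I$ infinite, and every element of $D$ less than every element of $S$; $(\widetilde D,\widetilde S)$ extends $(D,S)$ if $D\subseteq\widetilde D\subseteq D\cup S$ and $\widetilde S\subseteq S$; a set $G$ satisfies $(D,S)$ if $D\subseteq G\subseteq D\cup S$. An index of $(D,S)$ codes the canonical index of $D$ and numbers $e_0,e_1$ with $\Phi_{e_0}^{A_0}=\Phi_{e_1}^{A_1}=S$, and a collection of $\mathcal I$-conditions is $\Sigma^0_n(\mathcal I)$-definable if the set of indices of its members is $\Sigma^0_n(\mathcal I)$. A set $G$ is $n$-$\mathcal I$-generic if for every $\Sigma^0_n(\mathcal I)$-definable collection $\mathcal C$ of $\mathcal I$-conditions,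 $G$ satisfies a member of $\mathcal C$ or satisfies an $\mathcal I$-condition having no extension in $\mathcal C$. A set $S$ is $\mathcal I$-hereditarily uniformly $A$-computing if there is an $e\in\omega$ such that $\Phi_e^T=A$ for every infinite $T\subseteq S$ in $\mathcal I$. Let $\mathcal I$ be a Turing ideal. (a) Let $n\ge 4$, let $A$ be a $\Delta^0_n(\mathcal I)$ set, and let $G$ be $n$-$\mathcal I$-generic. Then $A\le_T G$ if and only if $G$ is contained in some $\mathcal I$-hereditarily uniformly $A$-computing set $S\in\mathcal I$. (b) Let $A$ be any set, and let $G$ be a $4$-$\mathcal I$-generic set contained in a set $S\in\mathcal I$ such that every infinite subset of $S$ in $\mathcal I$ has an infinite $\mathcal I$-hereditarily uniformly $A$-computing subset in $\mathcal I$. Then $A\le_T G$. -/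

import Mathlib

noncomputable section

namespace MathiasIdeal

/-! ## Turing functionals and reducibility -/

open Classical in
/-- The characteristic function of a set of natural numbers. -/
def charFun (X : Set ℕ) : ℕ →. ℕ := fun n => Part.some (if n ∈ X then 1 else 0)

open Classical in
/-- The initial segment of length `k` of (the characteristic function of) `X`. -/
def initSeg (X : Set ℕ) (k : ℕ) : List Bool := (List.range k).map fun i => decide (i ∈ X)

/-- The `e`-th Turing functional `Φₑ`, with oracle `X`: on input `n`, search for the first pair
`(t, k)` such that the `e`-th program, run on `n` together with the initial segment of length `k`
of the oracle, halts within `t` steps, and return its output. It is shown below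
(`isTuringFunctional_iff`) that these are, uniformly in the oracle, exactly the functionals given
by recursion relative to an oracle. -/
def functional (e : ℕ) (X : Set ℕ) : ℕ →. ℕ := fun n =>
  Nat.rfindOpt fun p =>
    Nat.Partrec.Code.evaln p.unpair.1 (Denumerable.ofNat Nat.Partrec.Code e)
      (Nat.pair (Encodable.encode (initSeg X p.unpair.2)) n)

/-- Turing reducibility between sets of natural numbers. -/
def TuringLE (A B : Set ℕ) : Prop := TuringReducible (charFun A) (charFun B)

/-- The join `A ⊕ B = {2n : n ∈ A} ∪ {2n + 1 : n ∈ B}`. -/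
def join (A B : Set ℕ) : Set ℕ := (fun n => 2 * n) '' A ∪ (fun n => 2 * n + 1) '' B

/-! ## The arithmetical hierarchy relative to a set -/

/-- `B` is `Σ⁰ₙ(X)`: for `n = 0` this means `X`-computable, and `B` is `Σ⁰ₙ₊₁(X)` if
`B = {x : ∃ y, ⟨x, y⟩ ∉ R}` for some `R` that is `Σ⁰ₙ(X)`. -/
def IsSigma (X : Set ℕ) : ℕ → Set ℕ → Prop
  | 0, B => TuringLE B X
  | n + 1, B => ∃ R : Set ℕ, IsSigma X n R ∧ B = {x | ∃ y, Nat.pair x y ∉ R}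

/-- `B` is `Π⁰ₙ(X)`. -/
def IsPi (X : Set ℕ) (n : ℕ) (B : Set ℕ) : Prop := IsSigma X n Bᶜ

/-- `B` is `Δ⁰ₙ(X)`. -/
def IsDelta (X : Set ℕ) (n : ℕ) (B : Set ℕ) : Prop := IsSigma X n B ∧ IsPi X n B

/-! ## Ideals and Mathias forcing -/

/-- A (countable) Turing ideal, presented, as usual, together with a choice of an exact pair. -/
structure TuringIdeal where
  /-- The members of the ideal. -/
  carrier : Set (Set ℕ)
  mem_of_le : ∀ {A B : Set ℕ}, TuringLE A B → B ∈ carrier → A ∈ carrier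
  join_mem : ∀ {A B : Set ℕ}, A ∈ carrier → B ∈ carrier → join A B ∈ carrier
  /-- The first half of the exact pair. -/
  left : Set ℕ
  /-- The second half of the exact pair. -/
  right : Set ℕ
  exact_pair : ∀ S : Set ℕ, S ∈ carrier ↔ TuringLE S left ∧ TuringLE S right

instance : Membership (Set ℕ) TuringIdeal := ⟨fun I S => S ∈ I.carrier⟩

/-- The set `A₀ ⊕ A₁`, for the chosen exact pair. `Σ⁰ₙ(I)` and `Δ⁰ₙ(I)` mean `Σ⁰ₙ` and `Δ⁰ₙ`
relative to this set. -/
def TuringIdeal.param (I : TuringIdeal) : Set ℕ := join I.left I.right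

/-- A Mathias condition `(D, S)`. -/
structure Condition where
  /-- The finite part `D`. -/
  stem : Finset ℕ
  /-- The infinite part `S`. -/
  reservoir : Set ℕ
  infinite : reservoir.Infinite
  lt : ∀ d ∈ stem, ∀ s ∈ reservoir, d < s

/-- `p` extends `q`. -/
def Condition.Extends (p q : Condition) : Prop :=
  q.stem ⊆ p.stem ∧ (p.stem : Set ℕ) ⊆ q.stem ∪ q.reservoir ∧ p.reservoir ⊆ q.reservoir

/-- `G` satisfies `p`. -/
def Condition.SatisfiedBy (p : Condition) (G : Set ℕ) : Prop :=
  (p.stem : Set ℕ) ⊆ G ∧ G ⊆ p.stem ∪ p.reservoir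

/-- The set of `I`-conditions. -/
def TuringIdeal.conditions (I : TuringIdeal) : Set Condition := {p | p.reservoir ∈ I}

/-- `i` is an index of the `I`-condition `p = (D, S)`: it codes the canonical index of `D`
together with indices `e₀`, `e₁` of `S` relative to the two halves of the exact pair. -/
def TuringIdeal.IsIndex (I : TuringIdeal) (p : Condition) (i : ℕ) : Prop :=
  ∃ e₀ e₁ : ℕ, functional e₀ I.left = charFun p.reservoir ∧
    functional e₁ I.right = charFun p.reservoir ∧
    i = Nat.pair (∑ d ∈ p.stem, 2 ^ d) (Nat.pair e₀ e₁)

/-- A collection of `I`-conditions is `Σ⁰ₙ(I)`-definable if the set of all indices of its members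
is `Σ⁰ₙ(I)`. -/
def TuringIdeal.SigmaDefinable (I : TuringIdeal) (n : ℕ) (C : Set Condition) : Prop :=
  IsSigma I.param n {i | ∃ p ∈ C, I.IsIndex p i}

/-- `G` meets `C`. -/
def Meets (G : Set ℕ) (C : Set Condition) : Prop := ∃ p ∈ C, p.SatisfiedBy G

/-- `G` avoids `C`, in the sense of forcing with `I`-conditions: `G` satisfies an `I`-condition
that has no extension in `C`. -/
def TuringIdeal.Avoids (I : TuringIdeal) (G : Set ℕ) (C : Set Condition) : Prop :=
  ∃ p ∈ I.conditions, p.SatisfiedBy G ∧ ∀ q ∈ C, ¬ q.Extends p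

/-- `G` is `n`-`I`-generic. -/
def TuringIdeal.IsGeneric (I : TuringIdeal) (n : ℕ) (G : Set ℕ) : Prop :=
  ∀ C : Set Condition, C ⊆ I.conditions → I.SigmaDefinable n C → Meets G C ∨ I.Avoids G C

/-- `S` is `I`-hereditarily uniformly `A`-computing: a single Turing functional computes `A` from
every infinite subset of `S` in `I`. -/
def TuringIdeal.HereditarilyUniformlyComputing (I : TuringIdeal) (A S : Set ℕ) : Prop :=
  ∃ e : ℕ, ∀ T ∈ I, T.Infinite → T ⊆ S → functional e T = charFun A

/-! ## The functionals `functional e` are the Turing functionals -/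

/-- The Turing functionals: the functionals obtained by recursion relative to an oracle, uniformly
in the oracle (compare `Nat.RecursiveIn`). -/
inductive IsTuringFunctional : (Set ℕ → ℕ →. ℕ) → Prop
  | zero : IsTuringFunctional fun _ _ => Part.some 0
  | succ : IsTuringFunctional fun _ n => Part.some (n + 1)
  | left : IsTuringFunctional fun _ n => Part.some n.unpair.1
  | right : IsTuringFunctional fun _ n => Part.some n.unpair.2
  | oracle : IsTuringFunctional charFun
  | pair {F H : Set ℕ → ℕ →. ℕ} (hF : IsTuringFunctional F) (hH : IsTuringFunctional H) :
      IsTuringFunctional fun X n => (Nat.pair <$> F X n <*> H X n)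
  | comp {F H : Set ℕ → ℕ →. ℕ} (hF : IsTuringFunctional F) (hH : IsTuringFunctional H) :
      IsTuringFunctional fun X n => (H X n).bind (F X)
  | prec {F H : Set ℕ → ℕ →. ℕ} (hF : IsTuringFunctional F) (hH : IsTuringFunctional H) :
      IsTuringFunctional fun X p =>
        let (a, n) := Nat.unpair p
        n.rec (F X a) fun y IH => IH.bind fun i => H X (Nat.pair a (Nat.pair y i))
  | rfind {F : Set ℕ → ℕ →. ℕ} (hF : IsTuringFunctional F) :
      IsTuringFunctional fun X a =>
        Nat.rfind fun n => (fun m => m = 0) <$> F X (Nat.pair a n)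

theorem initSeg_prefix (X : Set ℕ) {s t : ℕ} (h : s ≤ t) : initSeg X s <+: initSeg X t := by
  obtain ⟨u, rfl⟩ := Nat.exists_eq_add_of_le h
  simp [initSeg, List.range_add]

/-- `F` is the limit of a monotone primitive recursive approximation along initial segments. -/
def HasApprox (F : Set ℕ → ℕ →. ℕ) : Prop :=
  ∃ g : List Bool → ℕ → Option ℕ, Primrec₂ g ∧
    (∀ σ τ n y, σ <+: τ → y ∈ g σ n → y ∈ g τ n) ∧
    ∀ X n y, y ∈ F X n ↔ ∃ s, y ∈ g (initSeg X s) n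

theorem HasApprox.of_primrec {f : ℕ → ℕ} (hf : Primrec f) :
    HasApprox fun _ n => Part.some (f n) :=
  ⟨fun _ n => some (f n), (Primrec.option_some.comp (hf.comp Primrec.snd)),
    fun _ _ _ _ _ h => h, fun X n y => by simp [eq_comm]⟩

theorem HasApprox.oracle : HasApprox charFun := by
  refine ⟨fun σ n => (σ[n]?).map fun b => bif b then 1 else 0, ?_, ?_, ?_⟩
  · exact Primrec.option_map Primrec.list_getElem? 
      (Primrec.cond Primrec.snd (Primrec.const 1) (Primrec.const 0))
  · rintro σ τ n y ⟨ρ, rfl⟩ h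
    simp only [Option.mem_def, Option.map_eq_some_iff] at h ⊢
    obtain ⟨b, hb, rfl⟩ := h
    refine ⟨b, ?_, rfl⟩
    rw [List.getElem?_eq_some_iff] at hb
    obtain ⟨h1, h2⟩ := hb
    rw [List.getElem?_append_left h1, List.getElem?_eq_some_iff]
    exact ⟨h1, h2⟩
  · intro X n y
    simp only [charFun, Part.mem_some_iff, Option.mem_def, Option.map_eq_some_iff, initSeg,
      List.getElem?_map]
    constructor
    · rintro rfl
      refine ⟨n + 1, _, ⟨n, ?_, rfl⟩, ?_⟩
      · simp
      · by_cases h : n ∈ X <;> simp [h]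
    · rintro ⟨s, b, ⟨m, hm, rfl⟩, rfl⟩
      rw [List.getElem?_eq_some_iff] at hm
      obtain ⟨h1, h2⟩ := hm
      simp at h2
      subst h2
      by_cases h : n ∈ X <;> simp [h]

theorem approx_merge {g : List Bool → ℕ → Option ℕ}
    (hg : ∀ σ τ n y, σ <+: τ → y ∈ g σ n → y ∈ g τ n) {X : Set ℕ} {s t n y : ℕ} (h : s ≤ t)
    (hy : y ∈ g (initSeg X s) n) : y ∈ g (initSeg X t) n :=
  hg _ _ _ _ (initSeg_prefix X h) hy

theorem HasApprox.pair {F H : Set ℕ → ℕ →. ℕ} (hF : HasApprox F) (hH : HasApprox H) :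
    HasApprox fun X n => (Nat.pair <$> F X n <*> H X n) := by
  obtain ⟨f, f1, f2, f3⟩ := hF
  obtain ⟨h, h1, h2, h3⟩ := hH
  refine ⟨fun σ n => (f σ n).bind fun a => (h σ n).map fun b => Nat.pair a b, ?_, ?_, ?_⟩
  · refine Primrec.option_bind f1 ?_
    refine Primrec.option_map (h1.comp (Primrec.fst.comp Primrec.fst)
      (Primrec.snd.comp Primrec.fst)) ?_
    exact Primrec₂.natPair.comp (Primrec.snd.comp Primrec.fst) Primrec.snd
  · intro σ τ n y hp
    simp only [Option.mem_def, Option.bind_eq_some_iff, Option.map_eq_some_iff]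
    rintro ⟨a, ha, b, hb, rfl⟩
    exact ⟨a, f2 _ _ _ _ hp ha, b, h2 _ _ _ _ hp hb, rfl⟩
  · intro X n y
    simp only [Seq.seq, Part.map_eq_map, Part.mem_bind_iff, Part.mem_map_iff,
      Option.mem_def, Option.bind_eq_some_iff, Option.map_eq_some_iff]
    constructor
    · rintro ⟨_, ⟨a, ha, rfl⟩, b, hb, rfl⟩
      obtain ⟨s, hs⟩ := (f3 _ _ _).1 ha
      obtain ⟨t, ht⟩ := (h3 _ _ _).1 hb
      exact ⟨max s t, a, approx_merge f2 (le_max_left _ _) hs, b,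
        approx_merge h2 (le_max_right _ _) ht, rfl⟩
    · rintro ⟨s, a, ha, b, hb, rfl⟩
      exact ⟨_, ⟨a, (f3 _ _ _).2 ⟨s, ha⟩, rfl⟩, b, (h3 _ _ _).2 ⟨s, hb⟩, rfl⟩

theorem HasApprox.comp {F H : Set ℕ → ℕ →. ℕ} (hF : HasApprox F) (hH : HasApprox H) :
    HasApprox fun X n => (H X n).bind (F X) := by
  obtain ⟨f, f1, f2, f3⟩ := hF
  obtain ⟨h, h1, h2, h3⟩ := hH
  refine ⟨fun σ n => (h σ n).bind fun a => f σ a, ?_, ?_, ?_⟩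
  · exact Primrec.option_bind h1 (f1.comp (Primrec.fst.comp Primrec.fst) Primrec.snd)
  · intro σ τ n y hp
    simp only [Option.mem_def, Option.bind_eq_some_iff]
    rintro ⟨a, ha, hb⟩
    exact ⟨a, h2 _ _ _ _ hp ha, f2 _ _ _ _ hp hb⟩
  · intro X n y
    refine Part.mem_bind_iff.trans ?_
    simp only [Option.mem_def, Option.bind_eq_some_iff]
    constructor
    · rintro ⟨a, ha, hb⟩
      obtain ⟨s, hs⟩ := (h3 _ _ _).1 ha
      obtain ⟨t, ht⟩ := (f3 _ _ _).1 hb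
      exact ⟨max s t, a, approx_merge h2 (le_max_left _ _) hs,
        approx_merge f2 (le_max_right _ _) ht⟩
    · rintro ⟨s, a, ha, hb⟩
      exact ⟨a, (h3 _ _ _).2 ⟨s, ha⟩, (f3 _ _ _).2 ⟨s, hb⟩⟩

theorem HasApprox.prec {F H : Set ℕ → ℕ →. ℕ} (hF : HasApprox F) (hH : HasApprox H) :
    HasApprox fun X p =>
        let (a, n) := Nat.unpair p
        n.rec (F X a) fun y IH => IH.bind fun i => H X (Nat.pair a (Nat.pair y i)) := by
  obtain ⟨f, f1, f2, f3⟩ := hF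
  obtain ⟨h, h1, h2, h3⟩ := hH
  let G : List Bool → ℕ → ℕ → Option ℕ := fun σ a n =>
    n.rec (f σ a) fun y IH => IH.bind fun i => h σ (Nat.pair a (Nat.pair y i))
  have G2 : ∀ σ τ, σ <+: τ → ∀ a n y, y ∈ G σ a n → y ∈ G τ a n := by
    intro σ τ hp a n
    induction n with
    | zero => exact fun y hy => f2 _ _ _ _ hp hy
    | succ k ih =>
      intro y
      simp only [G, Option.mem_def, Option.bind_eq_some_iff]
      rintro ⟨i, hi, hy⟩
      exact ⟨i, ih i hi, h2 _ _ _ _ hp hy⟩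
  refine ⟨fun σ p => G σ p.unpair.1 p.unpair.2, ?_, fun σ τ p y hp => G2 σ τ hp _ _ y, ?_⟩
  · have : Primrec fun q : List Bool × ℕ => 
      (Nat.rec (f q.1 q.2.unpair.1) (fun y IH => Option.bind IH fun i =>
        h q.1 (Nat.pair q.2.unpair.1 (Nat.pair y i))) q.2.unpair.2 : Option ℕ) := by
      refine Primrec.nat_rec' (h := fun q r => Option.bind r.2 fun i =>
          h q.1 (Nat.pair q.2.unpair.1 (Nat.pair r.1 i)))
        (Primrec.snd.comp (Primrec.unpair.comp Primrec.snd))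
        (f1.comp Primrec.fst (Primrec.fst.comp (Primrec.unpair.comp Primrec.snd))) ?_
      refine Primrec.option_bind (Primrec.snd.comp Primrec.snd) ?_
      refine h1.comp (Primrec.fst.comp (Primrec.fst.comp Primrec.fst)) ?_
      refine Primrec₂.natPair.comp (Primrec.fst.comp (Primrec.unpair.comp
        (Primrec.snd.comp (Primrec.fst.comp Primrec.fst)))) ?_
      exact Primrec₂.natPair.comp (Primrec.fst.comp (Primrec.snd.comp Primrec.fst)) Primrec.snd
    exact this
  · intro X p
    simp only
    generalize p.unpair.1 = a
    generalize p.unpair.2 = n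
    induction n with
    | zero => exact fun y => f3 _ _ _
    | succ k ih =>
      intro y
      simp only [G, Part.mem_bind_iff, Option.mem_def, Option.bind_eq_some_iff]
      constructor
      · rintro ⟨i, hi, hy⟩
        obtain ⟨s, hs⟩ := (ih i).1 hi
        obtain ⟨t, ht⟩ := (h3 _ _ _).1 hy
        exact ⟨max s t, i, G2 _ _ (initSeg_prefix X (le_max_left _ _)) _ _ _ hs,
          approx_merge h2 (le_max_right _ _) ht⟩
      · rintro ⟨s, i, hi, hy⟩
        exact ⟨i, (ih i).2 ⟨s, hi⟩, (h3 _ _ _).2 ⟨s, hy⟩⟩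

theorem HasApprox.rfind {F : Set ℕ → ℕ →. ℕ} (hF : HasApprox F) :
    HasApprox fun X a => Nat.rfind fun n => (fun m => m = 0) <$> F X (Nat.pair a n) := by
  obtain ⟨f, f1, f2, f3⟩ := hF
  let G : List Bool → ℕ → ℕ → Option ℕ := fun σ a n =>
    n.rec (some 0) fun j r => r.bind fun k =>
      if k = 0 then (f σ (Nat.pair a j)).map fun v => if v = 0 then j + 1 else 0 else some k
  have GS : ∀ σ a n, (0 ∈ G σ a n ↔ ∀ j < n, ∃ v ∈ f σ (Nat.pair a j), v ≠ 0) ∧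
      ∀ m, m + 1 ∈ G σ a n ↔ m < n ∧ 0 ∈ f σ (Nat.pair a m) ∧
        ∀ j < m, ∃ v ∈ f σ (Nat.pair a j), v ≠ 0 := by
    intro σ a n
    induction n with
    | zero => simp [G]
    | succ n ih =>
      have key : G σ a (n + 1) = (G σ a n).bind fun k =>
        if k = 0 then (f σ (Nat.pair a n)).map fun v => if v = 0 then n + 1 else 0
          else some k := rfl
      obtain ⟨ih0, ih1⟩ := ih
      rw [key]
      simp only [Option.mem_def, Option.bind_eq_some_iff] at ih0 ih1 ⊢
      constructor
      · constructor
        · rintro ⟨k, hk, h⟩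
          split_ifs at h with hk0
          · subst hk0
            obtain ⟨v, hv, hv0⟩ := Option.map_eq_some_iff.1 h
            intro j hj
            rcases Nat.lt_succ_iff_lt_or_eq.1 hj with hj | rfl
            · exact ih0.1 hk j hj
            · refine ⟨v, hv, ?_⟩
              rintro rfl
              simp at hv0
          · simp_all
        · intro hall
          refine ⟨0, ih0.2 fun j hj => hall j (by omega), ?_⟩
          obtain ⟨v, hv, hv0⟩ := hall n (by omega)
          simp [hv, hv0]
      · intro m
        constructor
        · rintro ⟨k, hk, h⟩
          split_ifs at h with hk0
          · subst hk0
            obtain ⟨v, hv, hv0⟩ := Option.map_eq_some_iff.1 h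
            split_ifs at hv0 with h0
            obtain rfl : n = m := by omega
            subst h0
            exact ⟨by omega, hv, ih0.1 hk⟩
          · obtain rfl : k = m + 1 := by simpa using h
            obtain ⟨a1, a2, a3⟩ := (ih1 m).1 hk
            exact ⟨by omega, a2, a3⟩
        · rintro ⟨hm, h0, hall⟩
          rcases Nat.lt_succ_iff_lt_or_eq.1 hm with hm | rfl
          · exact ⟨m + 1, (ih1 m).2 ⟨hm, h0, hall⟩, by simp⟩
          · exact ⟨0, ih0.2 hall, by simp [h0]⟩
  have spec : ∀ σ a y, y ∈ ((G σ a σ.length).bind fun k => if k = 0 then none else some (k - 1)) ↔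
      y < σ.length ∧ 0 ∈ f σ (Nat.pair a y) ∧ ∀ j < y, ∃ v ∈ f σ (Nat.pair a j), v ≠ 0 := by
    intro σ a y
    rw [← (GS σ a σ.length).2 y]
    simp only [Option.mem_def, Option.bind_eq_some_iff]
    constructor
    · rintro ⟨k, hk, h⟩
      split_ifs at h with hk0
      obtain rfl : k = y + 1 := by simp at h; omega
      exact hk
    · exact fun h => ⟨y + 1, h, by simp⟩
  refine ⟨fun σ a => (G σ a σ.length).bind fun k => if k = 0 then none else some (k - 1),
    ?_, ?_, ?_⟩
  · refine Primrec.option_bind ?_ ?_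
    · refine Primrec.nat_rec' (h := fun q (r : ℕ × Option ℕ) => r.2.bind fun k =>
          if k = 0 then (f q.1 (Nat.pair q.2 r.1)).map fun v => if v = 0 then r.1 + 1 else 0
            else some k) (Primrec.list_length.comp Primrec.fst) (Primrec.const _) ?_
      refine Primrec.option_bind (Primrec.snd.comp Primrec.snd) ?_
      refine Primrec.ite (Primrec.eq.comp Primrec.snd (Primrec.const 0)) ?_
        (Primrec.option_some.comp Primrec.snd)
      refine Primrec.option_map (f1.comp (Primrec.fst.comp (Primrec.fst.comp Primrec.fst))
        (Primrec₂.natPair.comp (Primrec.snd.comp (Primrec.fst.comp Primrec.fst))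
          (Primrec.fst.comp (Primrec.snd.comp Primrec.fst)))) ?_
      refine Primrec.ite (Primrec.eq.comp Primrec.snd (Primrec.const 0)) ?_ (Primrec.const 0)
      exact Primrec.succ.comp
        (Primrec.fst.comp (Primrec.snd.comp (Primrec.fst.comp Primrec.fst)))
    · exact Primrec.ite (Primrec.eq.comp Primrec.snd (Primrec.const 0)) (Primrec.const none)
        (Primrec.option_some.comp (Primrec.pred.comp Primrec.snd))
  · intro σ τ a y hp
    rw [spec, spec]
    rintro ⟨b1, b2, b3⟩
    refine ⟨lt_of_lt_of_le b1 hp.length_le, f2 _ _ _ _ hp b2, fun j hj => ?_⟩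
    obtain ⟨v, hv, hv0⟩ := b3 j hj
    exact ⟨v, f2 _ _ _ _ hp hv, hv0⟩
  · intro X a y
    simp only [spec]
    have hlen : ∀ s, (initSeg X s).length = s := fun s => by simp [initSeg]
    refine Nat.mem_rfind.trans ?_
    simp only [hlen, Part.map_eq_map, Part.mem_map_iff, decide_eq_true_eq,
      decide_eq_false_iff_not, f3]
    constructor
    · rintro ⟨⟨v, ⟨s, hs⟩, rfl⟩, hall⟩
      have : ∀ m ≤ y, ∃ t, ∀ j < m, ∃ v ∈ f (initSeg X t) (Nat.pair a j), v ≠ 0 := by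
        intro m
        induction m with
        | zero => exact fun _ => ⟨0, by simp⟩
        | succ m ih =>
          intro hm
          obtain ⟨t, ht⟩ := ih (by omega)
          obtain ⟨v, ⟨u, hu⟩, hv⟩ := hall (by omega : m < y)
          refine ⟨max t u, fun j hj => ?_⟩
          rcases Nat.lt_succ_iff_lt_or_eq.1 hj with hj | rfl
          · obtain ⟨w, hw, hw0⟩ := ht j hj
            exact ⟨w, approx_merge f2 (le_max_left _ _) hw, hw0⟩
          · exact ⟨v, approx_merge f2 (le_max_right _ _) hu, hv⟩
      obtain ⟨t, ht⟩ := this y le_rfl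
      refine ⟨max (y + 1) (max s t), by omega, approx_merge f2 (by omega) hs, fun j hj => ?_⟩
      obtain ⟨w, hw, hw0⟩ := ht j hj
      exact ⟨w, approx_merge f2 (by omega) hw, hw0⟩
    · rintro ⟨s, -, h0, hall⟩
      refine ⟨⟨0, ⟨s, h0⟩, rfl⟩, fun {j} hj => ?_⟩
      obtain ⟨w, hw, hw0⟩ := hall j hj
      exact ⟨w, ⟨s, hw⟩, hw0⟩

theorem IsTuringFunctional.hasApprox {F : Set ℕ → ℕ →. ℕ} (hF : IsTuringFunctional F) :
    HasApprox F := by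
  induction hF with
  | zero => exact .of_primrec (Primrec.const 0)
  | succ => exact .of_primrec Primrec.succ
  | left => exact .of_primrec (Primrec.fst.comp Primrec.unpair)
  | right => exact .of_primrec (Primrec.snd.comp Primrec.unpair)
  | oracle => exact .oracle
  | pair _ _ h1 h2 => exact .pair h1 h2
  | comp _ _ h1 h2 => exact .comp h1 h2
  | prec _ _ h1 h2 => exact .prec h1 h2
  | rfind _ h => exact .rfind h

theorem HasApprox.exists_functional {F : Set ℕ → ℕ →. ℕ} (hF : HasApprox F) :
    ∃ e, functional e = F := by
  obtain ⟨g, g1, g2, g3⟩ := hF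
  have hp : Partrec fun q : ℕ => (((Encodable.decode (α := List Bool) q.unpair.1).bind
      fun σ => g σ q.unpair.2 : Option ℕ) : Part ℕ) := by
    refine Computable.ofOption (Primrec.to_comp ?_)
    exact Primrec.option_bind (Primrec.decode.comp (Primrec.fst.comp Primrec.unpair))
      (g1.comp Primrec.snd (Primrec.snd.comp (Primrec.unpair.comp Primrec.fst)))
  obtain ⟨c, hc⟩ := Nat.Partrec.Code.exists_code.1 (Partrec.nat_iff.1 hp)
  refine ⟨Encodable.encode c, ?_⟩
  have hev : ∀ X t k n y, y ∈ c.evaln t (Nat.pair (Encodable.encode (initSeg X k)) n) →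
      y ∈ F X n := by
    intro X t k n y h
    have := Nat.Partrec.Code.evaln_sound h
    rw [hc] at this
    simp only [Nat.unpair_pair, Encodable.encodek, Option.bind_some, Part.mem_ofOption] at this
    exact (g3 _ _ _).2 ⟨k, this⟩
  funext X n
  refine Part.ext fun y => ?_
  constructor
  · intro h
    obtain ⟨p, hp⟩ := Nat.rfindOpt_spec h
    rw [Denumerable.ofNat_encode] at hp
    exact hev _ _ _ _ _ hp
  · intro h
    have hdom : (functional (Encodable.encode c) X n).Dom := by
      rw [functional, Nat.rfindOpt_dom]
      obtain ⟨s, hs⟩ := (g3 _ _ _).1 h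
      have : y ∈ c.eval (Nat.pair (Encodable.encode (initSeg X s)) n) := by
        rw [hc]
        simpa only [Nat.unpair_pair, Encodable.encodek, Option.bind_some, Part.mem_ofOption]
      obtain ⟨t, ht⟩ := Nat.Partrec.Code.evaln_complete.1 this
      exact ⟨Nat.pair t s, y, by simpa using ht⟩
    obtain ⟨z, hz⟩ := Part.dom_iff_mem.1 hdom
    obtain ⟨p, hp⟩ := Nat.rfindOpt_spec hz
    rw [Denumerable.ofNat_encode] at hp
    rwa [Part.mem_unique h (hev _ _ _ _ _ hp)]

theorem IsTuringFunctional.of_eq {F H : Set ℕ → ℕ →. ℕ} (hF : IsTuringFunctional F)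
    (h : ∀ X n, F X n = H X n) : IsTuringFunctional H :=
  (funext fun X => funext (h X) : F = H) ▸ hF

theorem IsTuringFunctional.of_partrec {f : ℕ →. ℕ} (hf : Nat.Partrec f) :
    IsTuringFunctional fun _ => f := by
  induction hf with
  | zero => exact .zero
  | succ => exact .succ
  | left => exact .left
  | right => exact .right
  | pair _ _ h1 h2 => exact .pair h1 h2
  | comp _ _ h1 h2 => exact .comp h1 h2
  | prec _ _ h1 h2 => exact .prec h1 h2
  | rfind _ h => exact .rfind h

theorem IsTuringFunctional.of_primrec {f : ℕ → ℕ} (hf : Primrec f) :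
    IsTuringFunctional fun _ n => Part.some (f n) :=
  .of_partrec (Nat.Partrec.of_primrec (Primrec.nat_iff.1 hf))

theorem IsTuringFunctional.initSeg :
    IsTuringFunctional fun X k => Part.some (Encodable.encode (initSeg X k)) := by
  let app : ℕ → ℕ := fun q => Encodable.encode
    (((Encodable.decode (α := List Bool) q.unpair.1.unpair.2.unpair.2).getD []) ++
      [decide (q.unpair.2 = 1)])
  have happ : Primrec app := by
    have u := Primrec.unpair
    refine Primrec.encode.comp (Primrec.list_append.comp (Primrec.option_getD.comp
      (Primrec.decode.comp (Primrec.snd.comp (u.comp (Primrec.snd.comp (u.comp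
        (Primrec.fst.comp u)))))) (Primrec.const [])) ?_)
    refine Primrec.list_cons.comp ?_ (Primrec.const [])
    exact (Primrec.eq.comp (Primrec.snd.comp u) (Primrec.const 1)).decide
  obtain ⟨bit, hbit⟩ : ∃ bit : Set ℕ → ℕ → Bool,
      ∀ X y, bit X y = @decide (y ∈ X) (Classical.propDecidable _) := ⟨_, fun _ _ => rfl⟩
  have hstep : IsTuringFunctional fun X q => Part.some
      (Encodable.encode ((((Encodable.decode (α := List Bool) q.unpair.2.unpair.2).getD []) ++
        [bit X q.unpair.2.unpair.1]))) := by
    have := (IsTuringFunctional.of_primrec happ).comp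
      ((IsTuringFunctional.of_primrec Primrec.id).pair (IsTuringFunctional.oracle.comp
        (IsTuringFunctional.of_primrec (f := fun q => q.unpair.2.unpair.1) (Primrec.fst.comp
          (Primrec.unpair.comp (Primrec.snd.comp Primrec.unpair))))))
    refine this.of_eq fun X q => ?_
    have hb : (Part.some (Nat.unpair (Nat.unpair q).2).1).bind (charFun X) =
      charFun X (Nat.unpair (Nat.unpair q).2).1 := Part.bind_some _ _
    rw [hb]
    by_cases h : (Nat.unpair (Nat.unpair q).2).1 ∈ X <;> simp [app, charFun, Seq.seq, h, hbit]
  have hrec := (IsTuringFunctional.of_primrec (f := fun _ => Encodable.encode ([] : List Bool))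
    (Primrec.const _)).prec hstep
  have := hrec.comp (IsTuringFunctional.of_primrec (f := fun k => Nat.pair 0 k)
    (Primrec₂.natPair.comp (Primrec.const 0) Primrec.id))
  refine this.of_eq fun X k => ?_
  simp only [Part.bind_some, Nat.unpair_pair]
  induction k with
  | zero => simp [MathiasIdeal.initSeg]
  | succ k ih =>
    simp only at ih ⊢
    rw [ih]
    simp [hbit, MathiasIdeal.initSeg, List.range_succ]

theorem IsTuringFunctional.functional (e : ℕ) : IsTuringFunctional (functional e) := by
  let ev : ℕ → Option ℕ := fun q =>
    Nat.Partrec.Code.evaln q.unpair.1.unpair.2.unpair.1 (Denumerable.ofNat Nat.Partrec.Code e)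
      (Nat.pair q.unpair.2 q.unpair.1.unpair.1)
  have hev : Primrec fun q => Encodable.encode (ev q) := by
    have u := Primrec.unpair
    refine Primrec.encode.comp ?_
    refine Nat.Partrec.Code.primrec_evaln.comp (Primrec.pair (Primrec.pair ?_ (Primrec.const _)) ?_)
    · exact Primrec.fst.comp (u.comp (Primrec.snd.comp (u.comp (Primrec.fst.comp u))))
    · exact Primrec₂.natPair.comp (Primrec.snd.comp u) (Primrec.fst.comp (u.comp
        (Primrec.fst.comp u)))
  let W : Set ℕ → ℕ → ℕ → Option ℕ := fun X n p =>
    Nat.Partrec.Code.evaln p.unpair.1 (Denumerable.ofNat Nat.Partrec.Code e)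
      (Nat.pair (Encodable.encode (MathiasIdeal.initSeg X p.unpair.2)) n)
  have hW : IsTuringFunctional fun X q =>
      Part.some (Encodable.encode (W X q.unpair.1 q.unpair.2)) := by
    have := (IsTuringFunctional.of_primrec hev).comp
      ((IsTuringFunctional.of_primrec Primrec.id).pair (IsTuringFunctional.initSeg.comp
        (IsTuringFunctional.of_primrec (f := fun q => q.unpair.2.unpair.2) (Primrec.snd.comp
          (Primrec.unpair.comp (Primrec.snd.comp Primrec.unpair))))))
    refine this.of_eq fun X q => ?_
    simp [ev, W, Seq.seq]
  have hW' := (IsTuringFunctional.of_primrec (f := fun k => 1 - k)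
    (Primrec.nat_sub.comp (Primrec.const 1) Primrec.id)).comp hW
  have hfind := hW'.rfind
  have hfin := ((IsTuringFunctional.of_primrec Primrec.pred).comp hW).comp
    ((IsTuringFunctional.of_primrec Primrec.id).pair hfind)
  refine hfin.of_eq fun X n => ?_
  change _ = Nat.rfindOpt (W X n)
  have : (Nat.rfind fun p => (fun m => decide (m = 0)) <$> (Part.some (Encodable.encode
      (W X (Nat.pair n p).unpair.1 (Nat.pair n p).unpair.2))).bind
        fun k => Part.some (1 - k)) = Nat.rfind fun p => ((W X n p).isSome : Part Bool) := by
    congr 1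
    funext p
    cases h : W X n p <;> simp [h]
  simp only [this, Nat.rfindOpt, Seq.seq, id]
  symm
  refine Part.ext fun y => ?_
  rw [Part.map_eq_map, Part.map_some, Part.bind_some, Part.bind_map]
  simp only [Nat.unpair_pair]
  constructor
  · intro h
    obtain ⟨p, hp, hy⟩ := Part.mem_bind_iff.1 h
    refine Part.mem_bind_iff.2 ⟨p, hp, ?_⟩
    simp only [Part.mem_ofOption, Option.mem_def] at hy
    simp [hy]
  · intro h
    obtain ⟨p, hp, hy⟩ := Part.mem_bind_iff.1 h
    refine Part.mem_bind_iff.2 ⟨p, hp, ?_⟩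
    have := Nat.rfind_spec hp
    simp only [Part.mem_some_iff, Part.coe_some] at this
    obtain ⟨v, hv⟩ := Option.isSome_iff_exists.1 this.symm
    simp only [hv, Encodable.encode_some, Part.bind_some, Part.mem_some_iff] at hy
    simpa [hv] using hy

/-- The sequence `functional 0, functional 1, …` enumerates exactly the Turing functionals. -/
theorem isTuringFunctional_iff {F : Set ℕ → ℕ →. ℕ} :
    IsTuringFunctional F ↔ ∃ e, functional e = F :=
  ⟨fun h => h.hasApprox.exists_functional, fun ⟨e, he⟩ => he ▸ .functional e⟩

/-- A partial function is recursive in `X`, in the sense of Mathlib, exactly if it is `Φₑ^X` for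
some `e`. -/
theorem recursiveIn_iff {X : Set ℕ} {f : ℕ →. ℕ} :
    RecursiveIn {charFun X} f ↔ ∃ e, functional e X = f := by
  rw [RecursiveIn.iff_nat]
  constructor
  · intro h
    obtain ⟨F, hF, rfl⟩ : ∃ F, IsTuringFunctional F ∧ F X = f := by
      induction h with
      | zero => exact ⟨_, .zero, rfl⟩
      | succ => exact ⟨_, .succ, rfl⟩
      | left => exact ⟨_, .left, rfl⟩
      | right => exact ⟨_, .right, rfl⟩
      | oracle g hg => exact ⟨_, .oracle, hg.symm⟩
      | pair _ _ h1 h2 =>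
        obtain ⟨F, hF, rfl⟩ := h1
        obtain ⟨H, hH, rfl⟩ := h2
        exact ⟨_, hF.pair hH, rfl⟩
      | comp _ _ h1 h2 =>
        obtain ⟨F, hF, rfl⟩ := h1
        obtain ⟨H, hH, rfl⟩ := h2
        exact ⟨_, hF.comp hH, rfl⟩
      | prec _ _ h1 h2 =>
        obtain ⟨F, hF, rfl⟩ := h1
        obtain ⟨H, hH, rfl⟩ := h2
        exact ⟨_, hF.prec hH, rfl⟩
      | rfind _ h1 =>
        obtain ⟨F, hF, rfl⟩ := h1
        exact ⟨_, hF.rfind, rfl⟩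
    obtain ⟨e, rfl⟩ := isTuringFunctional_iff.1 hF
    exact ⟨e, rfl⟩
  · rintro ⟨e, rfl⟩
    have h := IsTuringFunctional.functional e
    generalize functional e = F at h
    induction h with
    | zero => exact .zero
    | succ => exact .succ
    | left => exact .left
    | right => exact .right
    | oracle => exact .oracle _ rfl
    | pair _ _ h1 h2 => exact .pair h1 h2
    | comp _ _ h1 h2 => exact .comp h1 h2
    | prec _ _ h1 h2 => exact .prec h1 h2
    | rfind _ h => exact .rfind h

end MathiasIdeal

end

open MathiasIdeal

noncomputable section

namespace MathiasIdeal

open Encodable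

/-! ## Turing reducibility -/

/-! A computation from a generic set `G` that halts uses finitely many bits of `G`. These bits can
be forced by a condition, and they can be continued inside the ideal by elements of a reservoir.
Genericity is applied to a definable collection of conditions, and one of its two alternatives is
excluded.

If `G ⊆ S` and `Φₑ` computes `A` from every infinite subset of `S` in the ideal, then `Φₑ^G` is
total. Otherwise `G` satisfies a condition `(D, R)` no extension of which forces convergence at some
`x`. But `D ∪ (R ∩ S)` is an infinite subset of `S` in the ideal, so `Φₑ` converges on one of its
initial segments, and that segment can be forced. The values are correct because a finite part of
`G` continues along `S` to a member of the ideal (`IsGeneric.turingLE`).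

Conversely let `Φₑ^G = A`. Collect the conditions that, for some `x`, force a wrong value at `x` or
leave no compatible string on which `Φₑ` converges at `x`. For `A` in `Δ⁰ₙ(I)` with `n ≥ 4` this
collection is `Σ⁰ₙ(I)`, and `G` cannot meet it. So some `(D, R)` satisfied by `G` has no extension
in it: from any infinite `T ⊆ D ∪ R` in the ideal, a search over strings compatible with `D` and `T`
always halts, and always with the right answer. Hence `D ∪ R` is hereditarily uniformly
`A`-computing (`IsGeneric.exists_hereditarilyUniformlyComputing`).

For part (b), `A` lies in the ideal, so the conditions with hereditarily uniformly `A`-computing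
reservoir form a `Σ⁰₄(I)` collection. The density hypothesis on `S` rules out avoiding it, and
meeting it reduces to the first argument after a finite correction of the reservoir
(`IsGeneric.turingLE_of_forall_exists`).

The rest is complexity counting: being an index is `Π⁰₂(I)`, by `piPred_isConditionIndex`, and every
collection is described through indices. -/

theorem turingLE_iff {A X : Set ℕ} : TuringLE A X ↔ ∃ e, functional e X = charFun A :=
  recursiveIn_iff

theorem turingLE_iff_exists {A X : Set ℕ} :
    TuringLE A X ↔ ∃ F, IsTuringFunctional F ∧ F X = charFun A := by
  rw [turingLE_iff]
  constructor
  · rintro ⟨e, he⟩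
    exact ⟨_, .functional e, he⟩
  · rintro ⟨F, hF, h⟩
    obtain ⟨e, rfl⟩ := isTuringFunctional_iff.1 hF
    exact ⟨e, h⟩

theorem TuringLE.trans {A B X : Set ℕ} (h : TuringLE A B) (h' : TuringLE B X) : TuringLE A X :=
  TuringReducible.trans h h'

theorem TuringLE.preimage {B X : Set ℕ} (hB : TuringLE B X) {f : ℕ → ℕ} (hf : Primrec f) :
    TuringLE {x | f x ∈ B} X := by
  obtain ⟨F, hF, h⟩ := turingLE_iff_exists.1 hB
  refine turingLE_iff_exists.2 ⟨_, hF.comp (.of_primrec hf), ?_⟩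
  funext n
  exact (Part.bind_some _ _).trans (by simp [h, charFun])

theorem TuringLE.compl {B X : Set ℕ} (hB : TuringLE B X) : TuringLE Bᶜ X := by
  obtain ⟨F, hF, h⟩ := turingLE_iff_exists.1 hB
  refine turingLE_iff_exists.2 ⟨_, (IsTuringFunctional.of_primrec (f := fun k => 1 - k)
    (Primrec.nat_sub.comp (Primrec.const 1) Primrec.id)).comp hF, ?_⟩
  funext n
  by_cases hn : n ∈ B <;> simp [h, charFun, hn]

theorem TuringLE.inter {B C X : Set ℕ} (hB : TuringLE B X) (hC : TuringLE C X) :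
    TuringLE (B ∩ C) X := by
  obtain ⟨F, hF, h⟩ := turingLE_iff_exists.1 hB
  obtain ⟨H, hH, h'⟩ := turingLE_iff_exists.1 hC
  refine turingLE_iff_exists.2 ⟨_, (IsTuringFunctional.of_primrec
    (f := fun k => k.unpair.1 * k.unpair.2) (Primrec.nat_mul.comp (Primrec.fst.comp Primrec.unpair)
      (Primrec.snd.comp Primrec.unpair))).comp (hF.pair hH), ?_⟩
  funext n
  by_cases hn : n ∈ B <;> by_cases hn' : n ∈ C <;> simp [h, h', charFun, hn, hn', Seq.seq]

theorem TuringLE.union {B C X : Set ℕ} (hB : TuringLE B X) (hC : TuringLE C X) :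
    TuringLE (B ∪ C) X := by
  simpa [Set.compl_inter] using (hB.compl.inter hC.compl).compl

theorem TuringLE.of_primrecPred {p : ℕ → Prop} (hp : PrimrecPred p) (X : Set ℕ) :
    TuringLE {n | p n} X := by
  obtain ⟨_, hp⟩ := hp
  refine turingLE_iff_exists.2 ⟨_, .of_primrec (Primrec.cond hp (Primrec.const 1)
    (Primrec.const 0)), ?_⟩
  funext n
  by_cases hn : p n <;> simp [charFun, hn]

theorem TuringLE.of_finite {B : Set ℕ} (hB : B.Finite) (X : Set ℕ) : TuringLE B X := by
  have : PrimrecPred fun n => ∃ a ∈ hB.toFinset.toList, a = n :=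
    (Primrec.eq (α := ℕ)).exists_mem_list.comp (Primrec.const _) Primrec.id
  simpa using TuringLE.of_primrecPred this X

theorem turingLE_join_left (A B : Set ℕ) : TuringLE A (join A B) := by
  refine turingLE_iff_exists.2 ⟨_, IsTuringFunctional.oracle.comp (.of_primrec
    (f := fun n => 2 * n) (Primrec.nat_mul.comp (Primrec.const 2) Primrec.id)), ?_⟩
  funext n
  have : 2 * n ∈ join A B ↔ n ∈ A := by
    simp only [join, Set.mem_union, Set.mem_image]
    constructor
    · rintro (⟨m, hm, h⟩ | ⟨m, hm, h⟩)
      · obtain rfl : m = n := by omega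
        exact hm
      · omega
    · exact fun h => .inl ⟨n, h, rfl⟩
  refine (Part.bind_some _ _).trans ?_
  by_cases h : n ∈ A
  · simp [charFun, h, this.2 h]
  · simp [charFun, h, mt this.1 h]

theorem turingLE_join_right (A B : Set ℕ) : TuringLE B (join A B) := by
  refine turingLE_iff_exists.2 ⟨_, IsTuringFunctional.oracle.comp (.of_primrec
    (f := fun n => 2 * n + 1) (Primrec.succ.comp (Primrec.nat_mul.comp (Primrec.const 2)
      Primrec.id))), ?_⟩
  funext n
  have : 2 * n + 1 ∈ join A B ↔ n ∈ B := by
    simp only [join, Set.mem_union, Set.mem_image]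
    constructor
    · rintro (⟨m, hm, h⟩ | ⟨m, hm, h⟩)
      · omega
      · obtain rfl : m = n := by omega
        exact hm
    · exact fun h => .inr ⟨n, h, rfl⟩
  refine (Part.bind_some _ _).trans ?_
  by_cases h : n ∈ B
  · simp [charFun, h, this.2 h]
  · simp [charFun, h, mt this.1 h]

/-! ## Closure properties of the arithmetical hierarchy -/

theorem IsSigma.mono_oracle {X Y : Set ℕ} (h : TuringLE X Y) {n : ℕ} {B : Set ℕ}
    (hB : IsSigma X n B) : IsSigma Y n B := by
  induction n generalizing B with
  | zero => exact TuringLE.trans hB h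
  | succ n ih =>
    obtain ⟨R, hR, rfl⟩ := hB
    exact ⟨R, ih hR, rfl⟩

theorem IsSigma.preimage {X : Set ℕ} {n : ℕ} {B : Set ℕ} (hB : IsSigma X n B) {f : ℕ → ℕ}
    (hf : Primrec f) : IsSigma X n {x | f x ∈ B} := by
  induction n generalizing B f with
  | zero => exact TuringLE.preimage hB hf
  | succ n ih =>
    obtain ⟨R, hR, rfl⟩ := hB
    refine ⟨_, ih hR (f := fun w => Nat.pair (f w.unpair.1) w.unpair.2)
      (Primrec₂.natPair.comp (hf.comp (Primrec.fst.comp Primrec.unpair))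
        (Primrec.snd.comp Primrec.unpair)), ?_⟩
    simp

/-- The two closure properties are proved together: the matrix of a `Σ⁰ₙ₊₁` set is negated, so an
intersection at level `n + 1` needs a union at level `n`, and vice versa. -/
theorem IsSigma.inter_union {X : Set ℕ} {n : ℕ} {B C : Set ℕ} (hB : IsSigma X n B)
    (hC : IsSigma X n C) : IsSigma X n (B ∩ C) ∧ IsSigma X n (B ∪ C) := by
  induction n generalizing B C with
  | zero => exact ⟨TuringLE.inter hB hC, TuringLE.union hB hC⟩
  | succ n ih =>
    obtain ⟨R, hR, rfl⟩ := hB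
    obtain ⟨T, hT, rfl⟩ := hC
    have u := Primrec.unpair
    have h1 := hR.preimage (f := fun w => Nat.pair w.unpair.1 w.unpair.2.unpair.1)
      (Primrec₂.natPair.comp (Primrec.fst.comp u) (Primrec.fst.comp (u.comp (Primrec.snd.comp u))))
    have h2 := hT.preimage (f := fun w => Nat.pair w.unpair.1 w.unpair.2.unpair.2)
      (Primrec₂.natPair.comp (Primrec.fst.comp u) (Primrec.snd.comp (u.comp (Primrec.snd.comp u))))
    refine ⟨⟨_, (ih h1 h2).2, ?_⟩, ⟨_, (ih h1 h2).1, ?_⟩⟩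
    · ext x
      simp only [Set.mem_inter_iff, Set.mem_ofPred_eq, Set.mem_union, Nat.unpair_pair, not_or]
      constructor
      · rintro ⟨⟨y, hy⟩, z, hz⟩
        exact ⟨Nat.pair y z, by simpa using ⟨hy, hz⟩⟩
      · rintro ⟨w, hy, hz⟩
        exact ⟨⟨_, hy⟩, _, hz⟩
    · ext x
      simp only [Set.mem_inter_iff, Set.mem_ofPred_eq, Set.mem_union, Nat.unpair_pair, not_and_or]
      constructor
      · rintro (⟨y, hy⟩ | ⟨z, hz⟩)
        · exact ⟨Nat.pair y 0, by simpa using .inl hy⟩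
        · exact ⟨Nat.pair 0 z, by simpa using .inr hz⟩
      · rintro ⟨w, hy | hz⟩
        · exact .inl ⟨_, hy⟩
        · exact .inr ⟨_, hz⟩

theorem IsPi.isSigma_succ {X : Set ℕ} {n : ℕ} {B : Set ℕ} (hB : IsPi X n B) :
    IsSigma X (n + 1) B :=
  ⟨_, IsSigma.preimage hB (Primrec.fst.comp Primrec.unpair), by simp⟩

/-- Raising the level of the matrix `R` reduces everything to level `0`, where closure of the
computable sets under complement and a dummy quantifier suffice. -/
theorem IsSigma.succ {X : Set ℕ} {n : ℕ} {B : Set ℕ} (hB : IsSigma X n B) :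
    IsSigma X (n + 1) B := by
  induction n generalizing B with
  | zero => exact IsPi.isSigma_succ (TuringLE.compl hB)
  | succ n ih =>
    obtain ⟨R, hR, rfl⟩ := hB
    exact ⟨R, ih hR, rfl⟩

theorem IsSigma.mono {X : Set ℕ} {m n : ℕ} (h : m ≤ n) {B : Set ℕ} (hB : IsSigma X m B) :
    IsSigma X n B := by
  induction h with
  | refl => exact hB
  | step _ ih => exact ih.succ

theorem IsSigma.exists {X : Set ℕ} {n : ℕ} {B : Set ℕ} (hB : IsSigma X (n + 1) B) :
    IsSigma X (n + 1) {x | ∃ y, Nat.pair x y ∈ B} := by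
  obtain ⟨R, hR, rfl⟩ := hB
  have u := Primrec.unpair
  refine ⟨_, hR.preimage (f := fun w => Nat.pair (Nat.pair w.unpair.1 w.unpair.2.unpair.1)
    w.unpair.2.unpair.2) (Primrec₂.natPair.comp (Primrec₂.natPair.comp (Primrec.fst.comp u)
      (Primrec.fst.comp (u.comp (Primrec.snd.comp u))))
        (Primrec.snd.comp (u.comp (Primrec.snd.comp u)))), ?_⟩
  ext x
  simp only [Set.mem_ofPred_eq, Nat.unpair_pair]
  constructor
  · rintro ⟨y, z, h⟩
    exact ⟨Nat.pair y z, by simpa using h⟩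
  · rintro ⟨w, h⟩
    exact ⟨_, _, h⟩

/-! ## The arithmetical hierarchy for predicates on countable types -/

section

variable {α β : Type*} [Primcodable α] [Primcodable β]

/-- The predicate `p` is `Σ⁰ₙ(X)`. -/
def SigmaPred (X : Set ℕ) (n : ℕ) (p : α → Prop) : Prop :=
  ∃ B : Set ℕ, IsSigma X n B ∧ ∀ a, p a ↔ encode a ∈ B

/-- The predicate `p` is `Π⁰ₙ(X)`. -/
def PiPred (X : Set ℕ) (n : ℕ) (p : α → Prop) : Prop := SigmaPred X n fun a => ¬ p a

theorem sigmaPred_iff {X : Set ℕ} {n : ℕ} {p : ℕ → Prop} :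
    SigmaPred X n p ↔ IsSigma X n {x | p x} := by
  constructor
  · rintro ⟨B, hB, h⟩
    convert hB
    ext x
    exact h x
  · exact fun h => ⟨_, h, fun _ => Iff.rfl⟩

variable {X : Set ℕ} {n : ℕ} {p q : α → Prop}

theorem SigmaPred.of_eq (hp : SigmaPred X n p) (h : ∀ a, p a ↔ q a) : SigmaPred X n q :=
  (funext fun a => propext (h a) : p = q) ▸ hp

theorem SigmaPred.comp {p : β → Prop} (hp : SigmaPred X n p) {f : α → β} (hf : Primrec f) :
    SigmaPred X n fun a => p (f a) := by
  obtain ⟨B, hB, h⟩ := hp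
  -- `encode (some b)` is `encode b + 1`, which explains the predecessor. Numbers that code nothing
  -- are sent to `0`; their membership is irrelevant.
  refine ⟨_, hB.preimage (f := fun k => (encode ((decode (α := α) k).map f)).pred) ?_, ?_⟩
  · exact Primrec.pred.comp (Primrec.encode.comp (Primrec.option_map Primrec.decode
      (hf.comp Primrec.snd).to₂))
  · intro a
    simp [h]

theorem SigmaPred.and (hp : SigmaPred X n p) (hq : SigmaPred X n q) :
    SigmaPred X n fun a => p a ∧ q a := by
  obtain ⟨B, hB, h⟩ := hp
  obtain ⟨C, hC, h'⟩ := hq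
  exact ⟨_, (hB.inter_union hC).1, fun a => by simp [h, h']⟩

theorem SigmaPred.or (hp : SigmaPred X n p) (hq : SigmaPred X n q) :
    SigmaPred X n fun a => p a ∨ q a := by
  obtain ⟨B, hB, h⟩ := hp
  obtain ⟨C, hC, h'⟩ := hq
  exact ⟨_, (hB.inter_union hC).2, fun a => by simp [h, h']⟩

theorem SigmaPred.mono {m : ℕ} (hp : SigmaPred X m p) (h : m ≤ n) : SigmaPred X n p := by
  obtain ⟨B, hB, h'⟩ := hp
  exact ⟨B, hB.mono h, h'⟩

theorem SigmaPred.not (hp : SigmaPred X n p) : PiPred X n fun a => ¬ p a :=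
  hp.of_eq fun _ => not_not.symm

theorem PiPred.of_eq (hp : PiPred X n p) (h : ∀ a, p a ↔ q a) : PiPred X n q :=
  SigmaPred.of_eq hp fun a => not_congr (h a)

theorem PiPred.comp {p : β → Prop} (hp : PiPred X n p) {f : α → β} (hf : Primrec f) :
    PiPred X n fun a => p (f a) :=
  SigmaPred.comp hp hf

theorem PiPred.and (hp : PiPred X n p) (hq : PiPred X n q) : PiPred X n fun a => p a ∧ q a :=
  (SigmaPred.or hp hq).of_eq fun _ => not_and_or.symm

theorem PiPred.or (hp : PiPred X n p) (hq : PiPred X n q) : PiPred X n fun a => p a ∨ q a :=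
  (SigmaPred.and hp hq).of_eq fun _ => not_or.symm

theorem PiPred.imp (hp : SigmaPred X n p) (hq : PiPred X n q) : PiPred X n fun a => p a → q a :=
  (hp.not.or hq).of_eq fun _ => imp_iff_not_or.symm

theorem PiPred.sigma {m : ℕ} (hp : PiPred X m p) (h : m < n) : SigmaPred X n p := by
  obtain ⟨B, hB, h'⟩ := hp
  refine SigmaPred.mono (m := m + 1) ⟨Bᶜ, IsPi.isSigma_succ ?_, fun a => ?_⟩ h
  · rwa [IsPi, compl_compl]
  · rw [Set.mem_compl_iff, ← h', not_not]

theorem SigmaPred.pi {m : ℕ} (hp : SigmaPred X m p) (h : m < n) : PiPred X n p :=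
  PiPred.sigma (hp.of_eq fun _ => not_not.symm : PiPred X m fun a => ¬ p a) h

theorem SigmaPred.of_primrecPred (hp : PrimrecPred p) (X : Set ℕ) (n : ℕ) : SigmaPred X n p := by
  refine SigmaPred.mono (m := 0) ⟨_, TuringLE.of_primrecPred
    (p := fun k => ∃ a ∈ (decode (α := α) k).toList, p a) ?_ X, fun a => by simp⟩ n.zero_le
  refine hp.exists_mem_list.comp ?_
  refine (Primrec.option_casesOn Primrec.decode (Primrec.const [])
    (Primrec.list_cons.comp Primrec.snd (Primrec.const [])).to₂).of_eq fun k => ?_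
  cases decode (α := α) k <;> rfl

theorem PiPred.of_primrecPred (hp : PrimrecPred p) (X : Set ℕ) (n : ℕ) : PiPred X n p :=
  SigmaPred.of_primrecPred hp.not X n

theorem SigmaPred.exists (hn : 1 ≤ n) {p : α → β → Prop}
    (hp : SigmaPred X n fun q : α × β => p q.1 q.2) : SigmaPred X n fun a => ∃ b, p a b := by
  obtain ⟨n, rfl⟩ := Nat.exists_eq_succ_of_ne_zero (by omega : n ≠ 0)
  obtain ⟨B, hB, h⟩ := hp
  -- `B` is unconstrained on numbers that are not codes, so the numerical witness is restricted to
  -- the range of `encode`.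
  have hr := (sigmaPred_iff.1 (SigmaPred.of_primrecPred (Primcodable.mem_range_encode (α := β)) X
    (n + 1))).preimage (Primrec.snd.comp Primrec.unpair)
  refine ⟨_, (hB.inter_union hr).1.exists, fun a => ?_⟩
  simp only [Set.mem_inter_iff, Set.mem_ofPred_eq, Nat.unpair_pair]
  constructor
  · rintro ⟨b, hb⟩
    exact ⟨encode b, (h (a, b)).1 hb, b, rfl⟩
  · rintro ⟨_, hb, b, rfl⟩
    exact ⟨b, (h (a, b)).2 hb⟩

theorem PiPred.forall (hn : 1 ≤ n) {p : α → β → Prop}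
    (hp : PiPred X n fun q : α × β => p q.1 q.2) : PiPred X n fun a => ∀ b, p a b :=
  (SigmaPred.exists hn (p := fun a b => ¬ p a b) hp).of_eq fun _ => not_forall.symm

theorem SigmaPred.mono_oracle {Y : Set ℕ} (hp : SigmaPred X n p) (h : TuringLE X Y) :
    SigmaPred Y n p := by
  obtain ⟨B, hB, h'⟩ := hp
  exact ⟨B, hB.mono_oracle h, h'⟩

/-- The oracle itself computes its initial segments, so a primitive recursive test of one is already
`X`-computable. This is where the oracle enters all later complexity bounds. -/
theorem SigmaPred.initSeg {P : List Bool → α → Prop} (hP : PrimrecRel P) {f : α → ℕ}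
    (hf : Primrec f) (X : Set ℕ) (n : ℕ) : SigmaPred X n fun a => P (initSeg X (f a)) a := by
  obtain ⟨inst, hP⟩ := hP
  let _ : ∀ σ a, Decidable (P σ a) := fun σ a => inst (σ, a)
  let dec : ℕ → Option α := decode
  let sel : ℕ → ℕ := fun k =>
    ((Option.map f (dec k)).getD 0)
  have hsel : Primrec sel := Primrec.option_getD.comp (Primrec.option_map Primrec.decode
    (hf.comp Primrec.snd).to₂) (Primrec.const 0)
  let val : ℕ → ℕ := fun w => ((dec w.unpair.2).bind fun a =>
    Option.map (fun σ => bif decide (P σ a) then 1 else 0)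
      (decode (α := List Bool) w.unpair.1)).getD 0
  have hval : Primrec val := by
    refine Primrec.option_getD.comp (Primrec.option_bind (Primrec.decode.comp
      (Primrec.snd.comp Primrec.unpair)) ?_) (Primrec.const 0)
    refine Primrec.option_map (Primrec.decode.comp (Primrec.fst.comp
      (Primrec.unpair.comp Primrec.fst))) ?_
    have h : Primrec fun r : (ℕ × α) × List Bool => decide (P r.2 r.1.2) :=
      hP.comp (Primrec.pair Primrec.snd (Primrec.snd.comp Primrec.fst))
    exact (Primrec.cond h (Primrec.const 1) (Primrec.const 0)).to₂
  refine SigmaPred.mono (m := 0) ⟨{k | ∃ a, dec k = some a ∧ P (MathiasIdeal.initSeg X (f a)) a},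
    ?_, fun a => by simp [dec]⟩ n.zero_le
  refine turingLE_iff_exists.2 ⟨_, (IsTuringFunctional.of_primrec hval).comp
    ((IsTuringFunctional.initSeg.comp (.of_primrec hsel)).pair (.of_primrec Primrec.id)), ?_⟩
  funext k
  cases hk : dec k with
  | none => simp [charFun, sel, val, hk, Seq.seq]
  | some a =>
    by_cases h : P (MathiasIdeal.initSeg X (f a)) a <;> simp [charFun, sel, val, hk, h, Seq.seq]

end

/-! ## Stages of computations -/

section FirstHit

variable {α : Type*}

/-- The first output found by the search `h` along the initial segments of `σ`. -/
def firstHit (h : List Bool → ℕ → α → Option ℕ) (σ : List Bool) (a : α) : Option ℕ :=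
  (List.range (σ.length + 1)).findSome? fun p => h (σ.take p) p a

variable {h : List Bool → ℕ → α → Option ℕ}

theorem findSome?_range_eq_some {f : ℕ → Option ℕ} {n y : ℕ} :
    (List.range n).findSome? f = some y ↔ ∃ p < n, f p = some y ∧ ∀ q < p, f q = none := by
  induction n with
  | zero => simp
  | succ n ih =>
    rw [List.range_succ, List.findSome?_append, Option.or_eq_some_iff, ih]
    constructor
    · rintro (⟨p, hp, h⟩ | ⟨h, hn⟩)
      · exact ⟨p, by omega, h⟩
      · refine ⟨n, by omega, by simpa using hn, fun q hq => ?_⟩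
        exact List.findSome?_eq_none_iff.1 h q (List.mem_range.2 hq)
    · rintro ⟨p, hp, hy, h⟩
      rcases Nat.lt_succ_iff_lt_or_eq.1 hp with hp | rfl
      · exact .inl ⟨p, hp, hy, h⟩
      · exact .inr ⟨List.findSome?_eq_none_iff.2 fun q hq => h q (List.mem_range.1 hq),
          by simpa using hy⟩

theorem firstHit_eq_some {σ : List Bool} {a : α} {y : ℕ} :
    firstHit h σ a = some y ↔
      ∃ p ≤ σ.length, h (σ.take p) p a = some y ∧ ∀ q < p, h (σ.take q) q a = none := by
  simp only [firstHit, findSome?_range_eq_some, Nat.lt_succ_iff]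

/-- Trial `p` sees only the first `p` bits, so lengthening the string leaves the earlier trials
unchanged and the first hit remains the first hit. -/
theorem firstHit_mono {σ τ : List Bool} (hστ : σ <+: τ) {a : α} {y : ℕ}
    (hy : firstHit h σ a = some y) : firstHit h τ a = some y := by
  obtain ⟨p, hp, h1, h2⟩ := firstHit_eq_some.1 hy
  have key : ∀ q ≤ p, τ.take q = σ.take q := by
    intro q hq
    obtain ⟨ρ, rfl⟩ := hστ
    exact List.take_append_of_le_length (hq.trans hp)
  refine firstHit_eq_some.2 ⟨p, hp.trans hστ.length_le, ?_, fun q hq => ?_⟩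
  · rw [key p le_rfl, h1]
  · rw [key q hq.le, h2 q hq]

@[simp] theorem length_initSeg (X : Set ℕ) (s : ℕ) : (initSeg X s).length = s := by
  simp [initSeg]

theorem take_initSeg (X : Set ℕ) {p s : ℕ} (h : p ≤ s) : (initSeg X s).take p = initSeg X p := by
  obtain ⟨ρ, hρ⟩ := initSeg_prefix X h
  rw [← hρ, List.take_left' (length_initSeg X p)]

theorem mem_rfindOpt_iff {f : ℕ → Option ℕ} {y : ℕ} :
    y ∈ Nat.rfindOpt f ↔ ∃ p, f p = some y ∧ ∀ q < p, f q = none := by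
  refine Part.mem_bind_iff.trans ?_
  simp only [Part.mem_ofOption, Option.mem_def]
  constructor
  · rintro ⟨p, hp, hy⟩
    refine ⟨p, hy, fun q hq => ?_⟩
    have := (Nat.mem_rfind.1 hp).2 hq
    simpa using this
  · rintro ⟨p, hy, h⟩
    exact ⟨p, Nat.mem_rfind.2 ⟨by simp [hy], fun hq => by simp [h _ hq]⟩, hy⟩

theorem mem_rfindOpt_initSeg {X : Set ℕ} {a : α} {y : ℕ} :
    y ∈ Nat.rfindOpt (fun p => h (initSeg X p) p a) ↔
      ∃ s, firstHit h (initSeg X s) a = some y := by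
  simp only [mem_rfindOpt_iff, firstHit_eq_some, length_initSeg]
  constructor
  · rintro ⟨p, hp, hq⟩
    refine ⟨p, p, le_rfl, by rwa [take_initSeg X le_rfl], fun q hqp => ?_⟩
    rw [take_initSeg X hqp.le, hq q hqp]
  · rintro ⟨s, p, hp, hy, hq⟩
    refine ⟨p, by rwa [take_initSeg X hp] at hy, fun q hqp => ?_⟩
    have := hq q hqp
    rwa [take_initSeg X (hqp.le.trans hp)] at this

theorem primrec_firstHit [Primcodable α]
    (hh : Primrec fun r : List Bool × ℕ × α => h r.1 r.2.1 r.2.2) :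
    Primrec₂ (firstHit h) := by
  have : Primrec fun r : List Bool × α => ((List.range (r.1.length + 1)).filterMap
      fun p => h (r.1.take p) p r.2).head? := by
    refine Primrec.list_head?.comp (Primrec.listFilterMap (Primrec.list_range.comp
      (Primrec.succ.comp (Primrec.list_length.comp Primrec.fst))) ?_)
    exact hh.comp (Primrec.pair (Primrec.list_take.comp Primrec.snd
      (Primrec.fst.comp Primrec.fst)) (Primrec.pair Primrec.snd (Primrec.snd.comp Primrec.fst)))
  exact this.of_eq fun r => List.head?_filterMap

theorem exists_functional_eq_rfindOpt {h : List Bool → ℕ → ℕ → Option ℕ}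
    (hh : Primrec fun r : List Bool × ℕ × ℕ => h r.1 r.2.1 r.2.2) :
    ∃ e, ∀ X n, functional e X n = Nat.rfindOpt fun p => h (initSeg X p) p n := by
  obtain ⟨e, he⟩ := HasApprox.exists_functional
    (F := fun X n => Nat.rfindOpt fun p => h (initSeg X p) p n)
    ⟨firstHit h, primrec_firstHit hh, fun _ _ _ _ h => firstHit_mono h,
      fun _ _ _ => mem_rfindOpt_initSeg⟩
  exact ⟨e, fun X n => by rw [he]⟩

end FirstHit

/-- One step of the computation of `Φₑ` on input `n`, for `a = (e, n)`. -/
def evalStep (σ : List Bool) (p : ℕ) (a : ℕ × ℕ) : Option ℕ :=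
  Nat.Partrec.Code.evaln p.unpair.1 (Denumerable.ofNat Nat.Partrec.Code a.1)
    (Nat.pair (encode (σ.take p.unpair.2)) a.2)

/-- The value of `Φₑ^σ(n)`, if the computation halts within the finite string `σ`. -/
def approx (σ : List Bool) (e n : ℕ) : Option ℕ := firstHit evalStep σ (e, n)

theorem primrec_approx : Primrec fun r : List Bool × ℕ × ℕ => approx r.1 r.2.1 r.2.2 := by
  refine (primrec_firstHit (h := evalStep) ?_).comp Primrec.fst Primrec.snd
  have u : Primrec fun r : List Bool × ℕ × ℕ × ℕ => r.2.1.unpair :=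
    Primrec.unpair.comp (Primrec.fst.comp Primrec.snd)
  refine Nat.Partrec.Code.primrec_evaln.comp (Primrec.pair (Primrec.pair (Primrec.fst.comp u)
    ((Primrec.ofNat _).comp (Primrec.fst.comp (Primrec.snd.comp Primrec.snd)))) ?_)
  exact Primrec₂.natPair.comp (Primrec.encode.comp (Primrec.list_take.comp (Primrec.snd.comp u)
    Primrec.fst)) (Primrec.snd.comp (Primrec.snd.comp Primrec.snd))

theorem primrec_approx_comp {α : Type*} [Primcodable α] {σ : α → List Bool} {e n : α → ℕ}
    (hσ : Primrec σ) (he : Primrec e) (hn : Primrec n) :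
    Primrec fun a => approx (σ a) (e a) (n a) :=
  primrec_approx.comp (hσ.pair (he.pair hn))

theorem approx_mono {σ τ : List Bool} (h : σ <+: τ) {e n y : ℕ} (hy : approx σ e n = some y) :
    approx τ e n = some y :=
  firstHit_mono h hy

/-- The use principle. Truncating the oracle at stage `p` loses nothing, since the segment length
tried at stage `p` is `p.unpair.2 ≤ p`. -/
theorem mem_functional_iff {e n y : ℕ} {X : Set ℕ} :
    y ∈ functional e X n ↔ ∃ s, approx (initSeg X s) e n = some y := by
  simp only [approx, ← mem_rfindOpt_initSeg]
  have : (fun p => evalStep (initSeg X p) p (e, n)) = fun p => Nat.Partrec.Code.evaln p.unpair.1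
      (Denumerable.ofNat Nat.Partrec.Code e)
        (Nat.pair (encode (initSeg X p.unpair.2)) n) := by
    funext p
    rw [evalStep, take_initSeg X (Nat.unpair_right_le p)]
  rw [this, functional]

theorem initSeg_congr {X Y : Set ℕ} {s : ℕ} (h : ∀ k < s, k ∈ X ↔ k ∈ Y) :
    initSeg X s = initSeg Y s := by
  refine List.map_congr_left fun k hk => ?_
  simp [h k (List.mem_range.1 hk)]

theorem getD_initSeg {X : Set ℕ} {k s : ℕ} :
    (initSeg X s).getD k false = true ↔ k < s ∧ k ∈ X := by
  by_cases h : k < s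
  · simp [initSeg, h]
  · simp [initSeg, h]

theorem eq_initSeg_iff {σ : List Bool} {X : Set ℕ} :
    σ = initSeg X σ.length ↔ ∀ k < σ.length, (σ.getD k false = true ↔ k ∈ X) := by
  constructor
  · intro h k hk
    rw [h, getD_initSeg, and_iff_right hk]
  · intro h
    refine List.ext_getElem (by simp) fun k hk _ => ?_
    have := h k hk
    rw [List.getD_eq_getElem _ _ hk] at this
    rw [Bool.eq_iff_iff, this]
    simp [initSeg]

theorem sigmaPred_mem_functional (X : Set ℕ) :
    SigmaPred X 1 fun r : ℕ × ℕ × ℕ => r.2.2 ∈ functional r.1 X r.2.1 := by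
  have hP : PrimrecRel fun (σ : List Bool) (r : (ℕ × ℕ × ℕ) × ℕ) =>
      approx σ r.1.1 r.1.2.1 = some r.1.2.2 := by
    have f : Primrec fun r : List Bool × (ℕ × ℕ × ℕ) × ℕ => r.2.1 := Primrec.fst.comp Primrec.snd
    exact Primrec.eq.comp (primrec_approx_comp Primrec.fst (Primrec.fst.comp f)
      (Primrec.fst.comp (Primrec.snd.comp f)))
        (Primrec.option_some.comp (Primrec.snd.comp (Primrec.snd.comp f)))
  exact (SigmaPred.exists le_rfl (p := fun (r : ℕ × ℕ × ℕ) s =>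
    approx (initSeg X s) r.1 r.2.1 = some r.2.2) (SigmaPred.initSeg hP Primrec.snd X 1)).of_eq
      fun r => mem_functional_iff.symm

/-- Masking the bits in `D` is primitive recursive and respects extension of strings, so the masked
computation is again a monotone approximation. -/
theorem exists_functional_eq_diff (e : ℕ) (D : Finset ℕ) :
    ∃ e', ∀ X, functional e' X = functional e (X \ D) := by
  let mask : List Bool → List Bool := fun σ => (List.range σ.length).map fun k =>
    σ.getD k false && !decide (k ∈ D)
  have hD : PrimrecPred fun k => k ∈ D :=
    (((Primrec.eq (α := ℕ)).exists_mem_list.comp (Primrec.const D.toList) Primrec.id)).of_eq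
      fun k => by simp
  have hmask : Primrec mask := by
    refine Primrec.list_map (Primrec.list_range.comp Primrec.list_length) ?_
    exact Primrec.and.comp ((Primrec.list_getD false).comp Primrec.fst Primrec.snd)
      (Primrec.not.comp ((hD.comp Primrec.snd).decide))
  have hmi : ∀ X s, mask (initSeg X s) = initSeg (X \ D) s := by
    intro X s
    simp only [mask, length_initSeg]
    refine List.map_congr_left fun k hk => ?_
    rw [Bool.eq_iff_iff, Bool.and_eq_true, getD_initSeg, and_iff_right (List.mem_range.1 hk)]
    simp
  have hmono : ∀ σ τ, σ <+: τ → mask σ <+: mask τ := by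
    rintro σ _ ⟨ρ, rfl⟩
    simp only [mask, List.length_append, List.range_add, List.map_append]
    have key : (List.range σ.length).map (fun k => (σ ++ ρ).getD k false && !decide (k ∈ D)) =
        (List.range σ.length).map fun k => σ.getD k false && !decide (k ∈ D) := by
      refine List.map_congr_left fun k hk => ?_
      rw [List.getD_append _ _ _ _ (List.mem_range.1 hk)]
    rw [key]
    exact List.prefix_append _ _
  obtain ⟨e', he'⟩ := HasApprox.exists_functional (F := fun X n => functional e (X \ D) n)
    ⟨fun σ n => approx (mask σ) e n, primrec_approx_comp (hmask.comp Primrec.fst) (Primrec.const e)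
      Primrec.snd, fun σ τ n y h => approx_mono (hmono σ τ h),
      fun X n y => by simp only [hmi, mem_functional_iff, Option.mem_def]⟩
  exact ⟨e', fun X => by rw [he']⟩

/-! ## Indices of conditions -/

theorem primrec_testBit : Primrec₂ Nat.testBit := by
  have hpow : Primrec₂ fun a b : ℕ => a ^ b := Primrec₂.unpaired'.1 Nat.Primrec.pow
  have : PrimrecPred fun r : ℕ × ℕ => r.1 / 2 ^ r.2 % 2 = 1 :=
    Primrec.eq.comp (Primrec.nat_mod.comp (Primrec.nat_div.comp Primrec.fst
      (hpow.comp (Primrec.const 2) Primrec.snd)) (Primrec.const 2)) (Primrec.const 1)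
  exact this.decide.of_eq fun r => Nat.testBit_eq_decide_div_mod_eq.symm

theorem testBit_sum_two_pow (D : Finset ℕ) (k : ℕ) : (∑ d ∈ D, 2 ^ d).testBit k = true ↔ k ∈ D := by
  rw [← Nat.mem_bitIndices, ← List.mem_toFinset, Finset.toFinset_bitIndices_sum_two_pow]

theorem initSeg_eq_map_testBit (D : Finset ℕ) (s : ℕ) :
    initSeg D s = (List.range s).map (∑ d ∈ D, 2 ^ d).testBit := by
  refine List.map_congr_left fun k _ => ?_
  rw [Bool.eq_iff_iff, testBit_sum_two_pow]
  simp

theorem one_mem_functional_iff {e : ℕ} {X S : Set ℕ} (h : functional e X = charFun S) {x : ℕ} :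
    1 ∈ functional e X x ↔ x ∈ S := by
  by_cases hx : x ∈ S <;> simp [h, charFun, hx]

theorem zero_mem_functional_iff {e : ℕ} {X S : Set ℕ} (h : functional e X = charFun S) {x : ℕ} :
    0 ∈ functional e X x ↔ x ∉ S := by
  by_cases hx : x ∈ S <;> simp [h, charFun, hx]

theorem functional_eq_charFun {e : ℕ} {X S : Set ℕ}
    (h : ∀ x, (x ∈ S ∧ 1 ∈ functional e X x) ∨ (x ∉ S ∧ 0 ∈ functional e X x)) :
    functional e X = charFun S := by
  funext x
  rcases h x with ⟨hx, h⟩ | ⟨hx, h⟩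
  · rw [Part.eq_some_iff.2 h]
    simp [charFun, hx]
  · rw [Part.eq_some_iff.2 h]
    simp [charFun, hx]

section

variable {α : Type*} [Primcodable α]

theorem SigmaPred.mem_functional {X Y : Set ℕ} (h : TuringLE X Y) {f g y : α → ℕ}
    (hf : Primrec f) (hg : Primrec g) (hy : Primrec y) :
    SigmaPred Y 1 fun a => y a ∈ functional (f a) X (g a) :=
  ((sigmaPred_mem_functional X).mono_oracle h).comp (hf.pair (hg.pair hy))

end

/-! ### Boolean closure of the ideal and the complexity of indices -/

namespace TuringIdeal

variable (I : TuringIdeal)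

theorem left_le : TuringLE I.left I.param := turingLE_join_left _ _

theorem right_le : TuringLE I.right I.param := turingLE_join_right _ _

theorem mem_iff {S : Set ℕ} : S ∈ I ↔ TuringLE S I.left ∧ TuringLE S I.right := I.exact_pair S

variable {I}

theorem inter_mem {S T : Set ℕ} (hS : S ∈ I) (hT : T ∈ I) : S ∩ T ∈ I := by
  rw [mem_iff] at *
  exact ⟨hS.1.inter hT.1, hS.2.inter hT.2⟩

theorem union_mem {S T : Set ℕ} (hS : S ∈ I) (hT : T ∈ I) : S ∪ T ∈ I := by
  rw [mem_iff] at *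
  exact ⟨hS.1.union hT.1, hS.2.union hT.2⟩

theorem compl_mem {S : Set ℕ} (hS : S ∈ I) : Sᶜ ∈ I := by
  rw [mem_iff] at *
  exact ⟨hS.1.compl, hS.2.compl⟩

theorem finite_mem {S : Set ℕ} (hS : S.Finite) : S ∈ I :=
  I.mem_iff.2 ⟨.of_finite hS _, .of_finite hS _⟩

theorem diff_mem {S T : Set ℕ} (hS : S ∈ I) (hT : T ∈ I) : S \ T ∈ I :=
  inter_mem hS (compl_mem hT)

variable (I)

/-- `(d, e₀, e₁)` is an index of an `I`-condition. -/
def IsConditionIndex (r : ℕ × ℕ × ℕ) : Prop :=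
  (∀ x, (1 ∈ functional r.2.1 I.left x ∧ 1 ∈ functional r.2.2 I.right x) ∨
    (0 ∈ functional r.2.1 I.left x ∧ 0 ∈ functional r.2.2 I.right x)) ∧
  (∀ m, ∃ x, m ≤ x ∧ 1 ∈ functional r.2.1 I.left x) ∧
  ∀ q : ℕ × ℕ, r.1.testBit q.1 = true → 1 ∈ functional r.2.1 I.left q.2 → q.1 < q.2

/-- Totality with agreement of the two computations, and infinity of the reservoir, are both of the
form "for all, there is a halting computation". -/
theorem piPred_isConditionIndex : PiPred I.param 2 I.IsConditionIndex := by
  have val : ∀ b : ℕ, SigmaPred I.param 1 fun q : (ℕ × ℕ × ℕ) × ℕ =>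
      b ∈ functional q.1.2.1 I.left q.2 := fun b => .mem_functional I.left_le
    (Primrec.fst.comp (Primrec.snd.comp Primrec.fst)) Primrec.snd (Primrec.const b)
  have val' : ∀ b : ℕ, SigmaPred I.param 1 fun q : (ℕ × ℕ × ℕ) × ℕ =>
      b ∈ functional q.1.2.2 I.right q.2 := fun b => .mem_functional I.right_le
    (Primrec.snd.comp (Primrec.snd.comp Primrec.fst)) Primrec.snd (Primrec.const b)
  refine .and (.forall (by norm_num) ?_) (.and (.forall (by norm_num) ?_)
    (.forall (by norm_num) ?_))
  · exact ((((val 1).and (val' 1)).or ((val 0).and (val' 0)))).pi (by norm_num)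
  · refine SigmaPred.pi (m := 1) (.exists le_rfl (p := fun (q : (ℕ × ℕ × ℕ) × ℕ) x =>
      q.2 ≤ x ∧ 1 ∈ functional q.1.2.1 I.left x) (.and (.of_primrecPred ?_ _ _) ?_)) (by norm_num)
    · exact Primrec.nat_le.comp (Primrec.snd.comp Primrec.fst) Primrec.snd
    · exact (val 1).comp (f := fun q : ((ℕ × ℕ × ℕ) × ℕ) × ℕ => (q.1.1, q.2))
        (.pair (Primrec.fst.comp Primrec.fst) Primrec.snd)
  · have u : Primrec fun q : (ℕ × ℕ × ℕ) × ℕ × ℕ => q.2.2 := Primrec.snd.comp Primrec.snd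
    have v : Primrec fun q : (ℕ × ℕ × ℕ) × ℕ × ℕ => q.2.1 := Primrec.fst.comp Primrec.snd
    refine PiPred.imp (.of_primrecPred ?_ _ _) (PiPred.imp ?_ (.of_primrecPred ?_ _ _))
    · exact Primrec.eq.comp (primrec_testBit.comp (Primrec.fst.comp Primrec.fst) v)
        (Primrec.const true)
    · exact ((val 1).comp (f := fun q : (ℕ × ℕ × ℕ) × ℕ × ℕ => (q.1, q.2.2))
        (.pair Primrec.fst u)).mono (by norm_num)
    · exact Primrec.nat_lt.comp v u

theorem isConditionIndex_iff {d e₀ e₁ : ℕ} : I.IsConditionIndex (d, e₀, e₁) ↔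
    ∃ p ∈ I.conditions, d = ∑ k ∈ p.stem, 2 ^ k ∧ functional e₀ I.left = charFun p.reservoir ∧
      functional e₁ I.right = charFun p.reservoir := by
  constructor
  · rintro ⟨h1, h2, h3⟩
    let S : Set ℕ := {x | 1 ∈ functional e₀ I.left x}
    have hz : ∀ x, 0 ∈ functional e₀ I.left x → x ∉ S := fun x hx hx' =>
      absurd (Part.mem_unique hx hx') (by norm_num)
    have hl : functional e₀ I.left = charFun S := functional_eq_charFun fun x =>
      (h1 x).imp (fun h => ⟨h.1, h.1⟩) fun h => ⟨hz x h.1, h.1⟩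
    have hr : functional e₁ I.right = charFun S := functional_eq_charFun fun x =>
      (h1 x).imp (fun h => ⟨h.1, h.2⟩) fun h => ⟨hz x h.1, h.2⟩
    refine ⟨⟨d.bitIndices.toFinset, S, ?_, ?_⟩, ?_, ?_, hl, hr⟩
    · refine Set.infinite_of_forall_exists_gt fun m => ?_
      obtain ⟨x, hx, hx'⟩ := h2 (m + 1)
      exact ⟨x, hx', hx⟩
    · intro k hk x hx
      exact h3 (k, x) (Nat.mem_bitIndices.1 (List.mem_toFinset.1 hk)) hx
    · exact I.mem_iff.2 ⟨turingLE_iff.2 ⟨_, hl⟩, turingLE_iff.2 ⟨_, hr⟩⟩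
    · exact (Finset.sum_toFinset_bitIndices_two_pow d).symm
  · rintro ⟨p, hp, rfl, hl, hr⟩
    refine ⟨fun x => ?_, fun m => ?_, fun q hq hq' => ?_⟩
    · simp only [one_mem_functional_iff hl, one_mem_functional_iff hr,
        zero_mem_functional_iff hl, zero_mem_functional_iff hr, and_self]
      exact em _
    · obtain ⟨x, hx, hx'⟩ := p.infinite.exists_gt m
      exact ⟨x, hx'.le, (one_mem_functional_iff hl).2 hx⟩
    · exact p.lt _ ((testBit_sum_two_pow _ _).1 hq) _ ((one_mem_functional_iff hl).1 hq')

variable {I}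

/-- The code `Q'` need only be correct on genuine indices. Being an index is `Π⁰₂(I)`, hence
`Σ⁰₃(I)`, and this is the source of `3 ≤ n`. -/
theorem sigmaDefinable {n : ℕ} (hn : 3 ≤ n) {Q : Condition → Prop} {Q' : ℕ × ℕ × ℕ → Prop}
    (hQ : SigmaPred I.param n Q')
    (h : ∀ p ∈ I.conditions, ∀ e₀ e₁, functional e₀ I.left = charFun p.reservoir →
      functional e₁ I.right = charFun p.reservoir →
        (Q p ↔ Q' (∑ k ∈ p.stem, 2 ^ k, e₀, e₁))) :
    I.SigmaDefinable n {p | p ∈ I.conditions ∧ Q p} := by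
  have := (((I.piPred_isConditionIndex.sigma (n := n) (by omega)).and hQ).comp
    (f := fun i : ℕ => (i.unpair.1, i.unpair.2.unpair.1, i.unpair.2.unpair.2))
      (.pair (Primrec.fst.comp Primrec.unpair) (Primrec.unpair.comp
        (Primrec.snd.comp Primrec.unpair))))
  refine sigmaPred_iff.1 (this.of_eq fun i => ?_)
  rw [isConditionIndex_iff]
  constructor
  · rintro ⟨⟨p, hp, hd, hl, hr⟩, hq⟩
    refine ⟨p, ⟨hp, (h p hp _ _ hl hr).2 (hd ▸ hq)⟩, _, _, hl, hr, ?_⟩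
    rw [← hd]
    simp
  · rintro ⟨p, ⟨hp, hq⟩, e₀, e₁, hl, hr, rfl⟩
    simp only [Nat.unpair_pair]
    exact ⟨⟨p, hp, rfl, hl, hr⟩, (h p hp _ _ hl hr).1 hq⟩

theorem IsGeneric.exists_or {n : ℕ} {G : Set ℕ} (hG : I.IsGeneric n G) {Q : Condition → Prop}
    (hQ : I.SigmaDefinable n {p | p ∈ I.conditions ∧ Q p}) :
    (∃ p ∈ I.conditions, p.SatisfiedBy G ∧ Q p) ∨
      ∃ p ∈ I.conditions, p.SatisfiedBy G ∧ ∀ q ∈ I.conditions, q.Extends p → ¬ Q q := by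
  rcases hG _ (fun p hp => hp.1) hQ with ⟨p, ⟨hp, hq⟩, hpG⟩ | ⟨p, hp, hpG, h⟩
  · exact .inl ⟨p, hp, hpG, hq⟩
  · exact .inr ⟨p, hp, hpG, fun q hq hqp hQq => h q ⟨hq, hQq⟩ hqp⟩

end TuringIdeal

/-! ## Strings and conditions -/

namespace Condition

/-- `σ` is an initial segment of every set satisfying `p`. -/
def Forces (p : Condition) (σ : List Bool) : Prop :=
  σ = initSeg p.stem σ.length ∧ ∀ z ∈ p.reservoir, σ.length ≤ z

end Condition

/-- `σ` is an initial segment of a set between `D` and `D ∪ S`. -/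
def Compat (D : Finset ℕ) (S : Set ℕ) (σ : List Bool) : Prop :=
  ∀ k, k < σ.length → (k ∈ D → σ.getD k false = true) ∧
    (σ.getD k false = true → k ∈ D ∨ k ∈ S)

theorem Compat.mono {D : Finset ℕ} {S T : Set ℕ} {σ : List Bool} (h : Compat D S σ)
    (hST : S ⊆ D ∪ T) : Compat D T σ :=
  fun k hk => ⟨(h k hk).1, fun hσ => ((h k hk).2 hσ).elim .inl fun hS => hST hS⟩

theorem compat_initSeg {D : Finset ℕ} {S G : Set ℕ} (h : (D : Set ℕ) ⊆ G) (h' : G ⊆ D ∪ S)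
    (s : ℕ) : Compat D S (initSeg G s) := by
  intro k hk
  rw [length_initSeg] at hk
  simp only [getD_initSeg, hk, true_and]
  exact ⟨fun hD => h hD, fun hG => h' hG⟩

theorem Condition.Forces.initSeg_eq {p : Condition} {σ : List Bool} (h : p.Forces σ) {G : Set ℕ}
    (hG : p.SatisfiedBy G) : initSeg G σ.length = σ := by
  refine Eq.trans (initSeg_congr fun k hk => ⟨fun hkG => ?_, fun hkD => hG.1 hkD⟩) h.1.symm
  exact (hG.2 hkG).resolve_right fun hkS => absurd (h.2 k hkS) (by omega)

/-- Put the ones of `σ` into the stem and drop everything below `σ.length` from the reservoir. Thus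
a halting computation on a compatible string becomes one forced by an extension. -/
theorem TuringIdeal.exists_extends_forces {I : TuringIdeal} {p : Condition}
    (hp : p ∈ I.conditions) {σ : List Bool} (hσ : Compat p.stem p.reservoir σ) :
    ∃ q ∈ I.conditions, q.Extends p ∧ q.Forces σ := by
  let E : Finset ℕ := {k ∈ Finset.range σ.length | σ.getD k false = true}
  have hE : ∀ k ∈ E, k < σ.length ∧ σ.getD k false = true := fun k hk => by simpa [E] using hk
  let q : Condition :=
    { stem := p.stem ∪ E
      reservoir := p.reservoir \ (Finset.range σ.length : Finset ℕ)
      infinite := p.infinite.sdiff (Finset.finite_toSet _)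
      lt := by
        intro d hd s hs
        rcases Finset.mem_union.1 hd with hd | hd
        · exact p.lt d hd s hs.1
        · have h1 := (hE d hd).1
          have h2 : ¬ s < σ.length := by simpa using hs.2
          omega }
  refine ⟨q, diff_mem hp (finite_mem (Finset.finite_toSet _)), ⟨Finset.subset_union_left, ?_,
    Set.sdiff_subset⟩, ?_, ?_⟩
  · intro k hk
    rcases Finset.mem_union.1 (Finset.mem_coe.1 hk) with hk | hk
    · exact .inl hk
    · exact (hσ k (hE k hk).1).2 (hE k hk).2
  · refine eq_initSeg_iff.2 fun k hk => ?_
    have : k ∈ (q.stem : Set ℕ) ↔ k ∈ p.stem ∨ σ.getD k false = true := by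
      simp only [q, Finset.coe_union, Set.mem_union, Finset.mem_coe]
      exact or_congr Iff.rfl ⟨fun h => (hE k h).2, fun h => by simpa [E, hk] using h⟩
    rw [this]
    exact ⟨.inr, fun h => h.elim (hσ k hk).1 id⟩
  · intro z hz
    simpa using hz.2

section

variable {α : Type*} [Primcodable α]

theorem primrecPred_eq_map_testBit {f : α → ℕ} {g : α → List Bool} (hf : Primrec f)
    (hg : Primrec g) :
    PrimrecPred fun a => g a = (List.range (g a).length).map (f a).testBit :=
  Primrec.eq.comp hg (Primrec.list_map (Primrec.list_range.comp (Primrec.list_length.comp hg))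
    (primrec_testBit.comp (hf.comp Primrec.fst) Primrec.snd))

variable {I : TuringIdeal}

/-- `p.Forces σ`, in terms of an index `r` of `p`. -/
def ForcesCode (I : TuringIdeal) (r : ℕ × ℕ × ℕ) (σ : List Bool) : Prop :=
  σ = (List.range σ.length).map r.1.testBit ∧
    ∀ z, 1 ∈ functional r.2.1 I.left z → σ.length ≤ z

theorem forces_iff {p : Condition} {e₀ e₁ : ℕ} (hl : functional e₀ I.left = charFun p.reservoir)
    {σ : List Bool} : p.Forces σ ↔ ForcesCode I (∑ k ∈ p.stem, 2 ^ k, e₀, e₁) σ := by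
  simp only [Condition.Forces, ForcesCode, initSeg_eq_map_testBit, one_mem_functional_iff hl]

theorem piPred_forcesCode {f : α → ℕ × ℕ × ℕ} {g : α → List Bool} (hf : Primrec f)
    (hg : Primrec g) : PiPred I.param 1 fun a => ForcesCode I (f a) (g a) := by
  refine .and (.of_primrecPred (primrecPred_eq_map_testBit (Primrec.fst.comp hf) hg) _ _)
    (.forall le_rfl (.imp ?_ (.of_primrecPred ?_ _ _)))
  · exact .mem_functional I.left_le (Primrec.fst.comp (Primrec.snd.comp (hf.comp Primrec.fst)))
      Primrec.snd (Primrec.const 1)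
  · exact Primrec.nat_le.comp (Primrec.list_length.comp (hg.comp Primrec.fst)) Primrec.snd

end

/-! ## Generic sets and computations -/

theorem exists_approx {e : ℕ} {A X : Set ℕ} (h : functional e X = charFun A) (x : ℕ) :
    ∃ s y, approx (initSeg X s) e x = some y := by
  obtain ⟨y, hy⟩ := Part.dom_iff_mem.1 (show (functional e X x).Dom by rw [h]; trivial)
  obtain ⟨s, hs⟩ := mem_functional_iff.1 hy
  exact ⟨s, y, hs⟩

section

variable {I : TuringIdeal} {n : ℕ} {G : Set ℕ}

/-- A reservoir element above `k` can always be moved into the stem, so no condition avoids having a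
stem element above `k`. -/
theorem TuringIdeal.IsGeneric.infinite (hn : 3 ≤ n) (hG : I.IsGeneric n G) : G.Infinite := by
  refine Set.infinite_of_forall_exists_gt fun k => ?_
  have hQ : I.SigmaDefinable n {p | p ∈ I.conditions ∧ ∃ d, d ∈ p.stem ∧ k < d} := by
    refine TuringIdeal.sigmaDefinable hn
      (Q' := fun r => ∃ d, r.1.testBit d = true ∧ k < d) ?_ ?_
    · refine .exists (by omega) (.and (.of_primrecPred ?_ _ _) (.of_primrecPred ?_ _ _))
      · exact Primrec.eq.comp (primrec_testBit.comp (Primrec.fst.comp Primrec.fst) Primrec.snd)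
          (Primrec.const true)
      · exact Primrec.nat_lt.comp (Primrec.const k) Primrec.snd
    · intro p _ e₀ e₁ _ _
      simp only [testBit_sum_two_pow]
  rcases hG.exists_or hQ with ⟨p, -, hpG, d, hd, hkd⟩ | ⟨p, hp, -, hno⟩
  · exact ⟨d, hpG.1 hd, hkd⟩
  · obtain ⟨x, hx, hkx⟩ := p.infinite.exists_gt k
    -- The forced string has length `x + 1`, just enough to contain bit `x`, which is one.
    obtain ⟨q, hq, hqp, hf⟩ := TuringIdeal.exists_extends_forces hp
      (compat_initSeg (S := p.reservoir) Set.subset_union_left le_rfl (x + 1))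
    refine absurd ⟨x, ?_, hkx⟩ (hno q hq hqp)
    have := (eq_initSeg_iff.1 hf.1 x (by simp)).1 (getD_initSeg.2 ⟨by omega, .inr hx⟩)
    exact this

/-- If `G` is generic and is contained in a hereditarily uniformly `A`-computing member of the
ideal, then `G` computes `A`. -/
theorem TuringIdeal.IsGeneric.turingLE (hn : 3 ≤ n) (hG : I.IsGeneric n G) {A S : Set ℕ}
    (hS : S ∈ I) (hAS : I.HereditarilyUniformlyComputing A S) (hGS : G ⊆ S) : TuringLE A G := by
  obtain ⟨e, he⟩ := hAS
  have hinf := hG.infinite hn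
  have htotal : ∀ x, ∃ s y, approx (initSeg G s) e x = some y := by
    intro x
    have hQ : I.SigmaDefinable n
        {p | p ∈ I.conditions ∧ ∃ σ, (approx σ e x).isSome = true ∧ p.Forces σ} := by
      refine TuringIdeal.sigmaDefinable hn
        (Q' := fun r => ∃ σ, (approx σ e x).isSome = true ∧ ForcesCode I r σ) ?_ ?_
      · refine .exists (by omega) (.and (.of_primrecPred ?_ _ _) ?_)
        · exact Primrec.eq.comp (Primrec.option_isSome.comp (primrec_approx_comp Primrec.snd
            (Primrec.const e) (Primrec.const x))) (Primrec.const true)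
        · exact (piPred_forcesCode Primrec.fst Primrec.snd).sigma (by omega)
      · intro p _ e₀ e₁ hl _
        simp only [forces_iff (e₁ := e₁) hl]
    rcases hG.exists_or hQ with ⟨p, -, hpG, σ, hσ, hf⟩ | ⟨p, hp, hpG, hno⟩
    · obtain ⟨y, hy⟩ := Option.isSome_iff_exists.1 hσ
      exact ⟨σ.length, y, by rw [hf.initSeg_eq hpG, hy]⟩
    · exfalso
      -- All of `G` except the finite stem lies in this intersection.
      have hT : (p.reservoir ∩ S).Infinite := by
        refine (hinf.sdiff p.stem.finite_toSet).mono fun k hk => ⟨?_, hGS hk.1⟩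
        exact (hpG.2 hk.1).resolve_left hk.2
      have hU := he (p.stem ∪ (p.reservoir ∩ S))
        (TuringIdeal.union_mem (TuringIdeal.finite_mem p.stem.finite_toSet)
          (TuringIdeal.inter_mem hp hS)) (hT.mono Set.subset_union_right)
        (Set.union_subset (hpG.1.trans hGS) Set.inter_subset_right)
      obtain ⟨s, y, hs⟩ := exists_approx hU x
      obtain ⟨q, hq, hqp, hf⟩ := TuringIdeal.exists_extends_forces hp (compat_initSeg
        (S := p.reservoir) Set.subset_union_left
          (Set.union_subset_union_right _ (Set.inter_subset_left (t := S))) s)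
      exact hno q hq hqp ⟨_, by rw [hs]; rfl, hf⟩
  refine turingLE_iff.2 ⟨e, ?_⟩
  funext x
  obtain ⟨s, y, hy⟩ := htotal x
  -- `G` need not belong to the ideal. Beyond the use `s` it is replaced by `S`, which gives an
  -- infinite subset of `S` in the ideal with the same computation at `x`.
  have hU := he (G ∩ (Finset.range s : Finset ℕ) ∪ S \ (Finset.range s : Finset ℕ))
    (TuringIdeal.union_mem (TuringIdeal.finite_mem ((Finset.finite_toSet _).inter_of_right _))
      (TuringIdeal.diff_mem hS (TuringIdeal.finite_mem (Finset.finite_toSet _))))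
    (((hinf.mono hGS).sdiff (Finset.finite_toSet _)).mono Set.subset_union_right)
    (Set.union_subset (Set.inter_subset_left.trans hGS) Set.sdiff_subset)
  rw [← hU, Part.eq_some_iff.2 (mem_functional_iff.2 ⟨s, hy⟩)]
  refine (Part.eq_some_iff.2 (mem_functional_iff.2 ⟨s, ?_⟩)).symm
  rw [← hy]
  congr 1
  refine initSeg_congr fun k hk => ?_
  simp [hk]

/-- Deleting `D` from the oracle brings it back inside `S`. This absorbs the stem of a condition
whose reservoir is hereditarily uniformly computing. -/
theorem TuringIdeal.HereditarilyUniformlyComputing.union_finset {A S : Set ℕ}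
    (h : I.HereditarilyUniformlyComputing A S) (D : Finset ℕ) :
    I.HereditarilyUniformlyComputing A (D ∪ S) := by
  obtain ⟨e, he⟩ := h
  obtain ⟨e', he'⟩ := exists_functional_eq_diff e D
  refine ⟨e', fun T hT hTinf hTS => ?_⟩
  rw [he']
  refine he _ (TuringIdeal.diff_mem hT (TuringIdeal.finite_mem D.finite_toSet))
    (hTinf.sdiff D.finite_toSet) fun k hk => ?_
  exact (hTS hk.1).resolve_left hk.2

/-! ## Searching for a compatible string -/

/-- The search, along the oracle string `τ`, for a string that is compatible with `D` and `τ` and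
on which the computation of `Φₑ` halts. -/
def compatSearch (D : Finset ℕ) (e : ℕ) (τ : List Bool) (p x : ℕ) : Option ℕ :=
  (decode (α := List Bool) p.unpair.1).bind fun σ =>
    if σ.length ≤ τ.length ∧ ∀ k < σ.length, (k ∈ D → σ.getD k false = true) ∧
      (σ.getD k false = true → k ∈ D ∨ τ.getD k false = true) then approx σ e x else none

theorem primrec_compatSearch (D : Finset ℕ) (e : ℕ) :
    Primrec fun r : List Bool × ℕ × ℕ => compatSearch D e r.1 r.2.1 r.2.2 := by
  have hD : PrimrecPred fun k => k ∈ D :=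
    (((Primrec.eq (α := ℕ)).exists_mem_list.comp (Primrec.const D.toList) Primrec.id)).of_eq
      fun k => by simp
  have hget : ∀ {f : ℕ × List Bool × List Bool → List Bool}, Primrec f →
      PrimrecPred fun q => (f q).getD q.1 false = true := fun hf =>
    Primrec.eq.comp ((Primrec.list_getD false).comp hf Primrec.fst) (Primrec.const true)
  have h1 := hget (Primrec.fst.comp Primrec.snd)
  have h2 := hget (Primrec.snd.comp Primrec.snd)
  have hD' := hD.comp (Primrec.fst (α := ℕ) (β := List Bool × List Bool))
  have hbody : PrimrecRel fun (k : ℕ) (q : List Bool × List Bool) =>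
      (k ∈ D → q.1.getD k false = true) ∧
        (q.1.getD k false = true → k ∈ D ∨ q.2.getD k false = true) :=
    ((hD'.not.or h1).and (h1.not.or (hD'.or h2))).of_eq fun q => by
      simp only [imp_iff_not_or]
  have hall : PrimrecRel fun (n : ℕ) (q : List Bool × List Bool) => ∀ k < n,
      (k ∈ D → q.1.getD k false = true) ∧
        (q.1.getD k false = true → k ∈ D ∨ q.2.getD k false = true) :=
    (hbody.forall_mem_list.comp (Primrec.list_range.comp Primrec.fst) Primrec.snd).of_eq (by simp)
  have hc : PrimrecPred fun q : List Bool × List Bool => q.1.length ≤ q.2.length ∧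
      ∀ k < q.1.length, (k ∈ D → q.1.getD k false = true) ∧
        (q.1.getD k false = true → k ∈ D ∨ q.2.getD k false = true) :=
    (Primrec.nat_le.comp (Primrec.list_length.comp Primrec.fst)
      (Primrec.list_length.comp Primrec.snd)).and
        (PrimrecRel.comp hall (Primrec.list_length.comp Primrec.fst) Primrec.id)
  refine Primrec.option_bind (Primrec.decode.comp (Primrec.fst.comp
    (Primrec.unpair.comp (Primrec.fst.comp Primrec.snd)))) ?_
  exact Primrec.ite (hc.comp (.pair Primrec.snd (Primrec.fst.comp Primrec.fst)))
    (primrec_approx_comp Primrec.snd (Primrec.const e)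
      (Primrec.snd.comp (Primrec.snd.comp Primrec.fst))) (Primrec.const none)

theorem compatSearch_initSeg {D : Finset ℕ} {e p x y : ℕ} {X : Set ℕ} :
    compatSearch D e (initSeg X p) p x = some y ↔ ∃ σ, decode p.unpair.1 = some σ ∧
      σ.length ≤ p ∧ Compat D X σ ∧ approx σ e x = some y := by
  simp only [compatSearch, Option.bind_eq_some_iff, Option.ite_none_right_eq_some, length_initSeg,
    getD_initSeg, and_assoc]
  refine exists_congr fun σ => and_congr_right fun _ => and_congr_right fun hp => ?_
  refine and_congr_left fun _ => forall₂_congr fun k hk => and_congr_right fun _ => ?_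
  rw [and_iff_right (by omega : k < p)]

/-- The string found need not be an initial segment of the oracle, so the value is only known to
come from some compatible string; correctness has to come from all compatible strings giving the
right value. -/
theorem exists_functional_compatSearch (D : Finset ℕ) (e : ℕ) :
    ∃ e', ∀ X x, (∀ y, y ∈ functional e' X x → ∃ σ, Compat D X σ ∧ approx σ e x = some y) ∧
      ((∃ σ y, Compat D X σ ∧ approx σ e x = some y) → ∃ y, y ∈ functional e' X x) := by
  obtain ⟨e', he'⟩ := exists_functional_eq_rfindOpt (primrec_compatSearch D e)
  refine ⟨e', fun X x => ⟨fun y hy => ?_, ?_⟩⟩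
  · rw [he'] at hy
    obtain ⟨p, hp⟩ := Nat.rfindOpt_spec hy
    obtain ⟨σ, -, -, h1, h2⟩ := compatSearch_initSeg.1 hp
    exact ⟨σ, h1, h2⟩
  · rintro ⟨σ, y, h1, h2⟩
    rw [he', ← Part.dom_iff_mem, Nat.rfindOpt_dom]
    -- The second component only makes the stage at least `σ.length`, so that enough of the oracle
    -- is visible.
    exact ⟨Nat.pair (encode σ) σ.length, y, compatSearch_initSeg.2
      ⟨σ, by simp, Nat.right_le_pair _ _, h1, h2⟩⟩

/-- Compatibility with a condition, in terms of an index `r` of the condition. -/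
def CompatCode (I : TuringIdeal) (r : ℕ × ℕ × ℕ) (σ : List Bool) : Prop :=
  ∀ k, k < σ.length → (r.1.testBit k = true → σ.getD k false = true) ∧
    (σ.getD k false = true → r.1.testBit k = true ∨ 1 ∈ functional r.2.1 I.left k)

theorem compat_iff {p : Condition} {e₀ e₁ : ℕ} (hl : functional e₀ I.left = charFun p.reservoir)
    {σ : List Bool} : Compat p.stem p.reservoir σ ↔
      CompatCode I (∑ k ∈ p.stem, 2 ^ k, e₀, e₁) σ := by
  simp only [Compat, CompatCode, testBit_sum_two_pow, one_mem_functional_iff hl]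

theorem piPred_compatCode (I : TuringIdeal) :
    PiPred I.param 2 fun q : (ℕ × ℕ × ℕ) × List Bool => CompatCode I q.1 q.2 := by
  have hbit : PrimrecPred fun q : ((ℕ × ℕ × ℕ) × List Bool) × ℕ => q.1.1.1.testBit q.2 = true :=
    Primrec.eq.comp (primrec_testBit.comp (Primrec.fst.comp (Primrec.fst.comp Primrec.fst))
      Primrec.snd) (Primrec.const true)
  have hget : PrimrecPred fun q : ((ℕ × ℕ × ℕ) × List Bool) × ℕ =>
      q.1.2.getD q.2 false = true := Primrec.eq.comp ((Primrec.list_getD false).comp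
        (Primrec.snd.comp Primrec.fst) Primrec.snd) (Primrec.const true)
  have hlt : PrimrecPred fun q : ((ℕ × ℕ × ℕ) × List Bool) × ℕ => q.2 < q.1.2.length :=
    Primrec.nat_lt.comp Primrec.snd (Primrec.list_length.comp (Primrec.snd.comp Primrec.fst))
  have hval : PiPred I.param 2 fun q : ((ℕ × ℕ × ℕ) × List Bool) × ℕ =>
      1 ∈ functional q.1.1.2.1 I.left q.2 :=
    (SigmaPred.mem_functional I.left_le (Primrec.fst.comp (Primrec.snd.comp
      (Primrec.fst.comp Primrec.fst))) Primrec.snd (Primrec.const 1)).pi (by norm_num)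
  exact .forall (by norm_num) (.imp (.of_primrecPred hlt _ _) (.and
    (.imp (.of_primrecPred hbit _ _) (.of_primrecPred hget _ _))
      (.imp (.of_primrecPred hget _ _) (.or (.of_primrecPred hbit _ _) hval))))

/-- If a generic set computes a `Δ⁰ₙ(I)` set `A`, then it is contained in a hereditarily uniformly
`A`-computing member of the ideal. -/
theorem TuringIdeal.IsGeneric.exists_hereditarilyUniformlyComputing (hn : 4 ≤ n)
    (hG : I.IsGeneric n G) {A : Set ℕ} (hA : IsDelta I.param n A) (hAG : TuringLE A G) :
    ∃ S ∈ I, I.HereditarilyUniformlyComputing A S ∧ G ⊆ S := by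
  obtain ⟨e, he⟩ := turingLE_iff.1 hAG
  -- The first alternative is a forced wrong value, and is `Σ⁰ₙ` because `A` is `Δ⁰ₙ`. The second,
  -- permanent divergence, is bounded by `Π⁰₃`; this is where `4 ≤ n` is used.
  have hQ : I.SigmaDefinable n {p | p ∈ I.conditions ∧ ∃ x,
      (∃ q : List Bool × ℕ, approx q.1 e x = some q.2 ∧ (x ∈ A ∧ q.2 ≠ 1 ∨ x ∉ A ∧ q.2 ≠ 0) ∧
        p.Forces q.1) ∨ ∀ σ, Compat p.stem p.reservoir σ → approx σ e x = none} := by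
    refine TuringIdeal.sigmaDefinable (by omega) (Q' := fun r => ∃ x,
      (∃ q : List Bool × ℕ, approx q.1 e x = some q.2 ∧ (x ∈ A ∧ q.2 ≠ 1 ∨ x ∉ A ∧ q.2 ≠ 0) ∧
        ForcesCode I r q.1) ∨ ∀ σ, CompatCode I r σ → approx σ e x = none) ?_ ?_
    · have hA1 : SigmaPred I.param n fun x => x ∈ A := sigmaPred_iff.2 hA.1
      have hA2 : SigmaPred I.param n fun x => x ∉ A := sigmaPred_iff.2 hA.2
      refine .exists (by omega) (.or (.exists (by omega) (.and (.of_primrecPred ?_ _ _)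
        (.and (.or (.and (hA1.comp ?_) (.of_primrecPred ?_ _ _))
          (.and (hA2.comp ?_) (.of_primrecPred ?_ _ _))) ?_))) ?_)
      · exact Primrec.eq.comp (primrec_approx_comp (Primrec.fst.comp Primrec.snd)
          (Primrec.const e) (Primrec.snd.comp Primrec.fst))
            (Primrec.option_some.comp (Primrec.snd.comp Primrec.snd))
      · exact Primrec.snd.comp Primrec.fst
      · exact (Primrec.eq.comp (Primrec.snd.comp Primrec.snd) (Primrec.const 1)).not
      · exact Primrec.snd.comp Primrec.fst
      · exact (Primrec.eq.comp (Primrec.snd.comp Primrec.snd) (Primrec.const 0)).not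
      · exact (piPred_forcesCode (Primrec.fst.comp Primrec.fst)
          (Primrec.fst.comp Primrec.snd)).sigma (by omega)
      · refine PiPred.sigma (m := 3) (.forall (by norm_num) (.imp (PiPred.sigma (m := 2)
          ((piPred_compatCode I).comp (f := fun q : ((ℕ × ℕ × ℕ) × ℕ) × List Bool => (q.1.1, q.2))
            (.pair (Primrec.fst.comp Primrec.fst) Primrec.snd)) (by norm_num))
              (.of_primrecPred ?_ _ _))) (by omega)
        exact Primrec.eq.comp (primrec_approx_comp Primrec.snd (Primrec.const e)
          (Primrec.snd.comp Primrec.fst)) (Primrec.const none)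
    · intro p _ e₀ e₁ hl _
      simp only [forces_iff (e₁ := e₁) hl, compat_iff (e₁ := e₁) hl]
  have hval : ∀ {x y}, y ∈ charFun A x → ¬ (x ∈ A ∧ y ≠ 1 ∨ x ∉ A ∧ y ≠ 0) := by
    intro x y hy
    by_cases hx : x ∈ A <;> simpa [charFun, hx] using hy
  rcases hG.exists_or hQ with ⟨p, -, hpG, x, ⟨⟨σ, y⟩, hσ, hy, hf⟩ | hnone⟩ | ⟨p, hp, hpG, hno⟩
  · refine absurd hy (hval ?_)
    rw [← he]
    exact mem_functional_iff.2 ⟨σ.length, by rw [hf.initSeg_eq hpG, hσ]⟩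
  · obtain ⟨s, y, hs⟩ := exists_approx he x
    rw [hnone _ (compat_initSeg hpG.1 hpG.2 s)] at hs
    cases hs
  -- A wrong value on a compatible string could be forced by an extension of `p`, against the choice
  -- of `p`.
  · have hright : ∀ {σ x y}, Compat p.stem p.reservoir σ → approx σ e x = some y →
        x ∈ A ∧ y = 1 ∨ x ∉ A ∧ y = 0 := by
      intro σ x y hσ hy
      obtain ⟨q, hq, hqp, hf⟩ := TuringIdeal.exists_extends_forces hp hσ
      by_contra hne
      refine hno q hq hqp ⟨x, .inl ⟨(σ, y), hy, ?_, hf⟩⟩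
      tauto
    obtain ⟨e', he'⟩ := exists_functional_compatSearch p.stem e
    refine ⟨p.stem ∪ p.reservoir, TuringIdeal.union_mem
      (TuringIdeal.finite_mem p.stem.finite_toSet) hp, ⟨e', fun T hT hTinf hTS => ?_⟩, hpG.2⟩
    refine functional_eq_charFun fun x => ?_
    have hsub : T \ p.stem ⊆ p.reservoir := fun k hk => (hTS hk.1).resolve_left hk.2
    -- Shrinking the reservoir to `T` keeps the condition an extension of `p`, so the divergence
    -- alternative fails for it and the search from `T` must halt.
    let q : Condition :=
      { stem := p.stem
        reservoir := T \ p.stem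
        infinite := hTinf.sdiff p.stem.finite_toSet
        lt := fun d hd s hs => p.lt d hd s (hsub hs) }
    have hx := hno q (TuringIdeal.diff_mem hT (TuringIdeal.finite_mem p.stem.finite_toSet))
      ⟨Finset.Subset.refl _, Set.subset_union_left, hsub⟩
    obtain ⟨σ, hσ, y, hy⟩ : ∃ σ, Compat p.stem (T \ p.stem) σ ∧ ∃ y, approx σ e x = some y := by
      by_contra hcon
      refine hx ⟨x, .inr fun σ hσ => ?_⟩
      by_contra hy
      exact hcon ⟨σ, hσ, Option.ne_none_iff_exists'.1 hy⟩
    obtain ⟨z, hz⟩ := (he' T x).2 ⟨σ, y, hσ.mono fun k hk => .inr hk.1, hy⟩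
    obtain ⟨τ, hτ, hτz⟩ := (he' T x).1 z hz
    rcases hright (hτ.mono hTS) hτz with ⟨hxA, rfl⟩ | ⟨hxA, rfl⟩
    · exact .inl ⟨hxA, hz⟩
    · exact .inr ⟨hxA, hz⟩

end

/-! ## Defining the hereditarily uniformly computing reservoirs -/

section

variable {I : TuringIdeal}

/-- `σ` is an initial segment of the set with index `e`. -/
def InitialCode (I : TuringIdeal) (e : ℕ) (σ : List Bool) : Prop :=
  ∀ k, k < σ.length → (σ.getD k false = true → ¬ 0 ∈ functional e I.left k) ∧
    (¬ σ.getD k false = true → ¬ 1 ∈ functional e I.left k)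

/-- Excluding the opposite value is equivalent to having the right one since the computation is
total and 0-1-valued. The negative form keeps the code `Π⁰₁`. -/
theorem initialCode_iff {e : ℕ} {U : Set ℕ} (h : functional e I.left = charFun U)
    {σ : List Bool} : InitialCode I e σ ↔ σ = initSeg U σ.length := by
  rw [eq_initSeg_iff]
  simp only [InitialCode, zero_mem_functional_iff h, one_mem_functional_iff h, not_not]
  exact forall₂_congr fun k _ => by tauto

theorem piPred_initialCode (I : TuringIdeal) :
    PiPred I.param 1 fun q : ℕ × List Bool => InitialCode I q.1 q.2 := by
  have hget : PrimrecPred fun q : (ℕ × List Bool) × ℕ => q.1.2.getD q.2 false = true :=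
    Primrec.eq.comp ((Primrec.list_getD false).comp (Primrec.snd.comp Primrec.fst) Primrec.snd)
      (Primrec.const true)
  have hlt : PrimrecPred fun q : (ℕ × List Bool) × ℕ => q.2 < q.1.2.length :=
    Primrec.nat_lt.comp Primrec.snd (Primrec.list_length.comp (Primrec.snd.comp Primrec.fst))
  have hval (b : ℕ) : SigmaPred I.param 1 fun q : (ℕ × List Bool) × ℕ =>
      b ∈ functional q.1.1 I.left q.2 :=
    .mem_functional I.left_le (Primrec.fst.comp Primrec.fst) Primrec.snd (Primrec.const b)
  exact .forall le_rfl (.imp (.of_primrecPred hlt _ _) (.and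
    (.imp (.of_primrecPred hget _ _) (hval 0).not)
      (.imp (.of_primrecPred hget.not _ _) (hval 1).not)))

/-- The set with index `j.1` is contained in the set with index `r.2.1`. -/
def SubsetCode (I : TuringIdeal) (r : ℕ × ℕ × ℕ) (j : ℕ × ℕ) : Prop :=
  ∀ x, ¬ (1 ∈ functional j.1 I.left x ∧ 0 ∈ functional r.2.1 I.left x)

theorem subsetCode_iff {d e₀ e₁ i₀ i₁ : ℕ} {S U : Set ℕ} (h : functional e₀ I.left = charFun S)
    (h' : functional i₀ I.left = charFun U) : SubsetCode I (d, e₀, e₁) (i₀, i₁) ↔ U ⊆ S := by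
  simp only [SubsetCode, zero_mem_functional_iff h, one_mem_functional_iff h', not_and, not_not]
  rfl

theorem piPred_subsetCode (I : TuringIdeal) :
    PiPred I.param 1 fun q : (ℕ × ℕ × ℕ) × ℕ × ℕ => SubsetCode I q.1 q.2 :=
  .forall le_rfl (SigmaPred.not (.and
    (.mem_functional I.left_le (Primrec.fst.comp (Primrec.snd.comp Primrec.fst)) Primrec.snd
      (Primrec.const 1))
    (.mem_functional I.left_le (Primrec.fst.comp (Primrec.snd.comp (Primrec.fst.comp Primrec.fst)))
      Primrec.snd (Primrec.const 0))))

/-- The functional `Φₑ` computes from the set with index `e₀` the set with index `a`. -/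
def ComputesCode (I : TuringIdeal) (a e e₀ : ℕ) : Prop :=
  ∀ x, ∃ q : List Bool × ℕ, InitialCode I e₀ q.1 ∧ approx q.1 e x = some q.2 ∧
    q.2 ∈ functional a I.left x

theorem computesCode_iff {a e e₀ : ℕ} {A U : Set ℕ} (hA : functional a I.left = charFun A)
    (hU : functional e₀ I.left = charFun U) :
    ComputesCode I a e e₀ ↔ functional e U = charFun A := by
  simp only [ComputesCode, initialCode_iff hU, hA]
  constructor
  · intro h
    funext x
    obtain ⟨⟨σ, y⟩, hσ, hy, hyA⟩ := h x
    simp only at hσ hy hyA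
    rw [Part.eq_some_iff.2 hyA, Part.eq_some_iff]
    exact mem_functional_iff.2 ⟨σ.length, by rw [← hσ, hy]⟩
  · intro h x
    obtain ⟨s, y, hy⟩ := exists_approx h x
    refine ⟨(initSeg U s, y), by simp, hy, ?_⟩
    rw [← h]
    exact mem_functional_iff.2 ⟨s, hy⟩

/-- As `A` is in the ideal, its values are given by a fixed index `a` and correctness at each `x` is
at most `Σ⁰₂(I)`. -/
theorem piPred_computesCode (I : TuringIdeal) (a : ℕ) :
    PiPred I.param 3 fun q : ℕ × ℕ => ComputesCode I a q.1 q.2 := by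
  have h1 : PiPred I.param 1 fun q : ((ℕ × ℕ) × ℕ) × List Bool × ℕ =>
      InitialCode I q.1.1.2 q.2.1 := (piPred_initialCode I).comp
    (f := fun q : ((ℕ × ℕ) × ℕ) × List Bool × ℕ => (q.1.1.2, q.2.1))
      (.pair (Primrec.snd.comp (Primrec.fst.comp Primrec.fst)) (Primrec.fst.comp Primrec.snd))
  have h2 : PrimrecPred fun q : ((ℕ × ℕ) × ℕ) × List Bool × ℕ =>
      approx q.2.1 q.1.1.1 q.1.2 = some q.2.2 := Primrec.eq.comp
    (primrec_approx_comp (Primrec.fst.comp Primrec.snd)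
      (Primrec.fst.comp (Primrec.fst.comp Primrec.fst)) (Primrec.snd.comp Primrec.fst))
    (Primrec.option_some.comp (Primrec.snd.comp Primrec.snd))
  have h3 : SigmaPred I.param 1 fun q : ((ℕ × ℕ) × ℕ) × List Bool × ℕ =>
      q.2.2 ∈ functional a I.left q.1.2 := .mem_functional I.left_le (Primrec.const a)
    (Primrec.snd.comp Primrec.fst) (Primrec.snd.comp Primrec.snd)
  exact .forall (by norm_num) (SigmaPred.pi (m := 2) (.exists (by norm_num)
    (.and (h1.sigma (by norm_num)) (.and (.of_primrecPred h2 _ _) (h3.mono (by norm_num)))))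
      (by norm_num))

theorem sigmaDefinable_hereditarilyUniformlyComputing {A : Set ℕ} (hA : A ∈ I) :
    I.SigmaDefinable 4 {p | p ∈ I.conditions ∧
      I.HereditarilyUniformlyComputing A p.reservoir} := by
  obtain ⟨a, ha⟩ := turingLE_iff.1 (I.mem_iff.1 hA).1
  -- An index with stem code `0` is just an index of an infinite member of the ideal, so `j` ranges
  -- over those. The matrix is `Π⁰₃`, and the choice of `e` makes it `Σ⁰₄`.
  refine TuringIdeal.sigmaDefinable (by norm_num) (Q' := fun r => ∃ e, ∀ j : ℕ × ℕ,
    I.IsConditionIndex (0, j) → SubsetCode I r j → ComputesCode I a e j.1) ?_ ?_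
  · have h1 : PiPred I.param 2 fun q : ((ℕ × ℕ × ℕ) × ℕ) × ℕ × ℕ =>
        I.IsConditionIndex (0, q.2) := I.piPred_isConditionIndex.comp
      (f := fun q : ((ℕ × ℕ × ℕ) × ℕ) × ℕ × ℕ => (0, q.2)) (.pair (Primrec.const 0) Primrec.snd)
    have h2 : PiPred I.param 1 fun q : ((ℕ × ℕ × ℕ) × ℕ) × ℕ × ℕ => SubsetCode I q.1.1 q.2 :=
      (piPred_subsetCode I).comp (f := fun q : ((ℕ × ℕ × ℕ) × ℕ) × ℕ × ℕ => (q.1.1, q.2))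
        (.pair (Primrec.fst.comp Primrec.fst) Primrec.snd)
    have h3 : PiPred I.param 3 fun q : ((ℕ × ℕ × ℕ) × ℕ) × ℕ × ℕ =>
        ComputesCode I a q.1.2 q.2.1 := (piPred_computesCode I a).comp
      (f := fun q : ((ℕ × ℕ × ℕ) × ℕ) × ℕ × ℕ => (q.1.2, q.2.1))
        (.pair (Primrec.snd.comp Primrec.fst) (Primrec.fst.comp Primrec.snd))
    exact .exists (by norm_num) (PiPred.sigma (m := 3) (.forall (by norm_num)
      (.imp (h1.sigma (by norm_num)) (.imp (h2.sigma (by norm_num)) h3))) (by norm_num))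
  · intro p _ e₀ e₁ hl _
    refine exists_congr fun e => ⟨?_, ?_⟩
    · rintro h ⟨i₀, i₁⟩ hj hsub
      obtain ⟨q, hq, -, hi, -⟩ := I.isConditionIndex_iff.1 hj
      exact (computesCode_iff ha hi).2 (h _ hq q.infinite ((subsetCode_iff hl hi).1 hsub))
    · intro h T hT hTinf hTS
      obtain ⟨i₀, hi₀⟩ := turingLE_iff.1 (I.mem_iff.1 hT).1
      obtain ⟨i₁, hi₁⟩ := turingLE_iff.1 (I.mem_iff.1 hT).2
      refine (computesCode_iff ha hi₀).1 (h (i₀, i₁) ?_ ((subsetCode_iff hl hi₀).2 hTS))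
      exact I.isConditionIndex_iff.2 ⟨⟨∅, T, hTinf, by simp⟩, hT, by simp, hi₀, hi₁⟩

/-- If every infinite subset in the ideal of a member `S` of the ideal has an infinite hereditarily
uniformly `A`-computing subset in the ideal, then every `4`-generic subset of `S` computes `A`. -/
theorem TuringIdeal.IsGeneric.turingLE_of_forall_exists {A G S : Set ℕ} (hG : I.IsGeneric 4 G)
    (hS : S ∈ I) (hGS : G ⊆ S)
    (h : ∀ T ∈ I, T.Infinite → T ⊆ S →
      ∃ U ∈ I, U.Infinite ∧ U ⊆ T ∧ I.HereditarilyUniformlyComputing A U) : TuringLE A G := by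
  have hinf := hG.infinite (by norm_num)
  -- A single hereditarily uniformly computing set `U` in the ideal computes `A`, and the ideal is
  -- closed downwards.
  have hA : A ∈ I := by
    obtain ⟨U, hU, hUinf, -, e, he⟩ := h S hS (hinf.mono hGS) le_rfl
    exact I.mem_of_le (turingLE_iff.2 ⟨e, he U hU hUinf le_rfl⟩) hU
  rcases hG.exists_or (sigmaDefinable_hereditarilyUniformlyComputing hA) with
    ⟨p, hp, hpG, hpA⟩ | ⟨p, hp, hpG, hno⟩
  · exact hG.turingLE (by norm_num) (TuringIdeal.union_mem
      (TuringIdeal.finite_mem p.stem.finite_toSet) hp) (hpA.union_finset p.stem) hpG.2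
  · have hT : (p.reservoir ∩ S).Infinite := by
      refine (hinf.sdiff p.stem.finite_toSet).mono fun k hk => ⟨?_, hGS hk.1⟩
      exact (hpG.2 hk.1).resolve_left hk.2
    -- Shrinking the reservoir of `p` to `U` gives an extension in the collection that `p` was
    -- supposed to avoid.
    obtain ⟨U, hU, hUinf, hUT, hUA⟩ :=
      h _ (TuringIdeal.inter_mem hp hS) hT Set.inter_subset_right
    have hUp : U ⊆ p.reservoir := hUT.trans Set.inter_subset_left
    exact absurd hUA (hno ⟨p.stem, U, hUinf, fun d hd s hs => p.lt d hd s (hUp hs)⟩ hU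
      ⟨Finset.Subset.refl _, Set.subset_union_left, hUp⟩)

end

end MathiasIdeal

end

theorem corollaryC (I : TuringIdeal) :
    (∀ n : ℕ, 4 ≤ n → ∀ A : Set ℕ, IsDelta I.param n A → ∀ G : Set ℕ, I.IsGeneric n G →
      (TuringLE A G ↔ ∃ S ∈ I, I.HereditarilyUniformlyComputing A S ∧ G ⊆ S)) ∧
    (∀ A G S : Set ℕ, I.IsGeneric 4 G → S ∈ I → G ⊆ S →
      (∀ T ∈ I, T.Infinite → T ⊆ S →
        ∃ U ∈ I, U.Infinite ∧ U ⊆ T ∧ I.HereditarilyUniformlyComputing A U) →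
      TuringLE A G) := by
  refine ⟨fun n hn A hA G hG => ⟨fun hAG => ?_, ?_⟩, fun A G S hG hS hGS h => ?_⟩
  · exact hG.exists_hereditarilyUniformlyComputing hn hA hAG
  · rintro ⟨S, hS, hAS, hGS⟩
    exact hG.turingLE (by omega) hS hAS hGS
  · exact hG.turingLE_of_forall_exists hS hGS h
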